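/- Let $N$ be a random variable with values in $\{0,1,2,\dots\}$ and let $Q, C$ be nonnegative real random variables. Attach to every node $v=(i_1,\dots,i_n)$ ($n\ge 0$, $i_k\ge 1$; the root is $\emptyset$) random variables $N_v, Q_v, C_v$, all mutually independent, with $N_v$, $Q_v$, $C_v$ distributed as $N$, $Q$, $C$ respectively. Define the generations of the random tree by $A_0=\{\emptyset\}$ and $$A_n=\{(i_1,\dots,i_n): (i_1,\dots,i_{n-1})\in A_{n-1},\ 1\le i_n\le N_{(i_1,\dots,i_{n-1})}\},\qquad n\ge 1,$$ and let $$W_n=\sum_{(i_1,\dots,i_n)\in A_n} Q_{(i_1,\dots,i_n)}\prod_{k=1}^n C_{(i_1,\dots,i_k)},\qquad R=\sum_{n=0}^\infty W_n\in[0,\infty].$$ Suppose that for some $\alpha>0$, $C^\alpha\log C$ (read as $0$ when $C=0$) is integrable with $0<E[C^\alpha\log C]<\infty$, that $E[N]\,E[C^\alpha]=1$ and $0<E[Q^\alpha]\,E[N^\alpha]<\infty$; if $\alpha>1$, assume further that $E[N]\,E[C]<1$. Then $$\log P(R>t)\sim-\alpha\log t,\qquad t\to\infty,$$ that is, $\log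 P(R>t)/\log t\to-\alpha$ as $t\to\infty$. -/

import Mathlib

open MeasureTheory ProbabilityTheory Filter Asymptotics
open scoped NNReal ENNReal

/-! A node `(i₁, …, iₙ)` of the infinite tree (with labels `iₖ ≥ 1`) is stored as the list
`[iₙ, …, i₁]`, so that `[]` is the root and `i :: v` is the `i`-th child of `v`. -/

namespace BranchingTree

/-- The set `Aₙ` of individuals of the `n`-th generation, when node `v` has `N v` children,
labelled `1, …, N v`. -/
def generation (N : List ℕ → ℕ) : ℕ → Finset (List ℕ)
  | 0 => {[]}
  | n + 1 => (generation N n).biUnion fun v => (Finset.Icc 1 (N v)).image fun i => i :: v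

/-- The weight of a node: the product of the factors `C` along the branch from the root to the
node. The root has weight `1`. -/
def weight (C : List ℕ → ℝ≥0) : List ℕ → ℝ≥0
  | [] => 1
  | i :: v => C (i :: v) * weight C v

/-- The total weight `Wₙ` of the `n`-th generation. -/
def generationWeight (N : List ℕ → ℕ) (Q C : List ℕ → ℝ≥0) (n : ℕ) : ℝ≥0 :=
  ∑ v ∈ generation N n, Q v * weight C v

/-- The total weight `R = W₀ + W₁ + W₂ + ⋯` of the tree, a priori possibly infinite. -/
noncomputable def totalWeight (N : List ℕ → ℕ) (Q C : List ℕ → ℝ≥0) : ℝ≥0∞ :=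
  ∑' n : ℕ, (generationWeight N Q C n : ℝ≥0∞)

/-- The random variables `Nt v`, `Qt v`, `Ct v` attached to the nodes `v` are copies of `N`, `Q`
and `C` respectively, and all of them together are mutually independent. -/
structure IsIIDMarking {Ω : Type*} [MeasurableSpace Ω] (P : Measure Ω)
    (N : Ω → ℕ) (Q C : Ω → ℝ≥0)
    (Nt : List ℕ → Ω → ℕ) (Qt Ct : List ℕ → Ω → ℝ≥0) : Prop where
  measurable_N : ∀ v, Measurable (Nt v)
  measurable_Q : ∀ v, Measurable (Qt v)
  measurable_C : ∀ v, Measurable (Ct v)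
  identDistrib_N : ∀ v, IdentDistrib (Nt v) N P P
  identDistrib_Q : ∀ v, IdentDistrib (Qt v) Q P P
  identDistrib_C : ∀ v, IdentDistrib (Ct v) C P P
  iIndepFun_marks : iIndepFun
    (Sum.elim (fun v ω => (Nt v ω : ℝ≥0)) (Sum.elim Qt Ct) :
      List ℕ ⊕ List ℕ ⊕ List ℕ → Ω → ℝ≥0) P

end BranchingTree

/-! Write φ(p) = E[N] E[C^p]. This function is convex with φ(α) = 1, and E[C^α log C] > 0 makes it
increase through α: φ < 1 just below α and φ > 1 (possibly infinite) above. The weight satisfies R =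
Q + ∑_{i ≤ N} C_i R_i, where the R_i are copies of R attached to the children.

Upper bound: for β < α close to α, E[R^β] < ∞, and Markov's inequality applies. If β ≤ 1,
subadditivity of x^β gives E[R^β] ≤ E[Q^β] + φ(β) E[R^β], made rigorous on finitely many
generations. If β > 1, the diagonal terms of the β-th power still contribute φ(β) E[R^β], up to a
factor close to 1, and the rest is controlled by moments of order max(1, β - 1); one inducts on the
exponent in unit steps (`exists_lintegral_partialWeight_rpow_le`). This uses φ < 1 on all of [1, α),
which E[N] E[C] < 1 supplies.

Lower bound: R > t as soon as some child has C_i R_i > t. After capping N and C, a Bonferroni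
inequality shows that P(R > t) is at least nearly E[N] P(CR > t) for large t. A bound c s^(-γ) with
γ > α is thereby reproduced with a constant larger by a factor ρ > 1. Small values of C involve
arbitrarily large s, where nothing is known yet, so the bound is propagated for s^(-γ) - T^(β-γ)
s^(-β), which is negative beyond T; the correction is harmless because φ(β) < 1
(`Real.exists_mul_rpow_neg_le_of_step`). -/

namespace BranchingTree

/-! ### Splitting the tree at the root -/

theorem mem_generation_succ_iff (N : List ℕ → ℕ) (n : ℕ) (w : List ℕ) :
    w ∈ generation N (n + 1) ↔
      ∃ i ∈ Finset.Icc 1 (N []), ∃ u ∈ generation (fun v => N (v ++ [i])) n, u ++ [i] = w := by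
  induction n generalizing w with
  | zero => simp [generation]
  | succ n ih =>
    rw [generation]
    simp only [Finset.mem_biUnion, Finset.mem_image, ih]
    constructor
    · rintro ⟨v, ⟨i, hi, u, hu, rfl⟩, j, hj, rfl⟩
      refine ⟨i, hi, j :: u, ?_, rfl⟩
      simp only [generation, Finset.mem_biUnion, Finset.mem_image]
      exact ⟨u, hu, j, hj, rfl⟩
    · rintro ⟨i, hi, u, hu, rfl⟩
      simp only [generation, Finset.mem_biUnion, Finset.mem_image] at hu
      obtain ⟨v, hv, j, hj, rfl⟩ := hu
      exact ⟨v ++ [i], ⟨i, hi, v, hv, rfl⟩, j, hj, rfl⟩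

theorem generation_succ_eq_biUnion (N : List ℕ → ℕ) (n : ℕ) :
    generation N (n + 1) = (Finset.Icc 1 (N [])).biUnion fun i =>
      (generation (fun v => N (v ++ [i])) n).image fun v => v ++ [i] := by
  ext w
  simp only [mem_generation_succ_iff, Finset.mem_biUnion, Finset.mem_image]

theorem weight_append_singleton (C : List ℕ → ℝ≥0) (v : List ℕ) (i : ℕ) :
    weight C (v ++ [i]) = C [i] * weight (fun u => C (u ++ [i])) v := by
  induction v with
  | nil => simp [weight]
  | cons j v ih => simp only [List.cons_append, weight, ih]; ring

theorem generationWeight_zero (N : List ℕ → ℕ) (Q C : List ℕ → ℝ≥0) :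
    generationWeight N Q C 0 = Q [] := by
  simp [generationWeight, generation, weight]

/-- Generations are defined by growth at the leaves, whereas self-similarity needs a splitting by
the first label. Nodes are stored in reverse, so that label is the last list entry, and appending
`[i]` embeds the i-th subtree. -/
theorem generationWeight_succ (N : List ℕ → ℕ) (Q C : List ℕ → ℝ≥0) (n : ℕ) :
    generationWeight N Q C (n + 1) = ∑ i ∈ Finset.Icc 1 (N []), C [i] *
      generationWeight (fun v => N (v ++ [i])) (fun v => Q (v ++ [i])) (fun v => C (v ++ [i])) n := by
  rw [generationWeight, generation_succ_eq_biUnion, Finset.sum_biUnion]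
  · refine Finset.sum_congr rfl fun i _ => ?_
    rw [Finset.sum_image (fun a _ b _ h => List.append_cancel_right h), generationWeight,
      Finset.mul_sum]
    refine Finset.sum_congr rfl fun v _ => ?_
    rw [weight_append_singleton]
    ring
  · intro i _ j _ hij
    rw [Function.onFun, Finset.disjoint_left]
    intro w hw hw'
    simp only [Finset.mem_image] at hw hw'
    obtain ⟨u, -, rfl⟩ := hw
    obtain ⟨v, -, h⟩ := hw'
    exact hij (by simpa using (List.append_inj' h rfl).2.symm)

/-! ### The weight as a function of the marks -/

/-- A realization of all the marks of the tree. -/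
abbrev Marks : Type := List ℕ ⊕ List ℕ ⊕ List ℕ → ℝ≥0

namespace Marks

/-- The position of a mark of the subtree rooted at the `i`-th child of the root. -/
def shift (i : ℕ) : List ℕ ⊕ List ℕ ⊕ List ℕ → List ℕ ⊕ List ℕ ⊕ List ℕ :=
  Sum.map (· ++ [i]) (Sum.map (· ++ [i]) (· ++ [i]))

/-- The marks of the subtree rooted at the `i`-th child of the root. -/
def subtree (i : ℕ) (x : Marks) : Marks := fun j => x (shift i j)

/-- The number of children of a node. -/
noncomputable def offspring (x : Marks) (v : List ℕ) : ℕ := ⌊x (.inl v)⌋₊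

/-- The weight of a generation. -/
noncomputable def genWeight (n : ℕ) (x : Marks) : ℝ≥0∞ :=
  generationWeight x.offspring (fun v => x (.inr (.inl v))) (fun v => x (.inr (.inr v))) n

/-- The weight of the first `n` generations. -/
noncomputable def partialWeight (n : ℕ) (x : Marks) : ℝ≥0∞ :=
  ∑ k ∈ Finset.range n, genWeight k x

/-- The weight of the whole tree. -/
noncomputable def total (x : Marks) : ℝ≥0∞ :=
  totalWeight x.offspring (fun v => x (.inr (.inl v))) (fun v => x (.inr (.inr v)))

theorem shift_injective (i : ℕ) : Function.Injective (shift i) := by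
  have h : Function.Injective (fun v : List ℕ => v ++ [i]) := List.append_left_injective [i]
  exact h.sumMap (h.sumMap h)

theorem shift_ne_shift {i j : ℕ} (hij : i ≠ j) (a b) : shift i a ≠ shift j b := by
  have h : ∀ u v : List ℕ, u ++ [i] ≠ v ++ [j] := fun u v h =>
    hij (by simpa using (List.append_inj' h rfl).2)
  rcases a with a | a | a <;> rcases b with b | b | b <;> simp [shift, hij]

theorem shift_ne_inl_nil (i : ℕ) (a) : shift i a ≠ .inl [] := by
  rcases a with a | a | a <;> simp [shift]

theorem genWeight_zero (x : Marks) : genWeight 0 x = x (.inr (.inl [])) := by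
  rw [genWeight, generationWeight_zero]

theorem genWeight_succ (n : ℕ) (x : Marks) :
    genWeight (n + 1) x = ∑ i ∈ Finset.Icc 1 (x.offspring []),
      (x.subtree i (.inr (.inr [])) : ℝ≥0∞) * genWeight n (x.subtree i) := by
  rw [genWeight, generationWeight_succ]
  push_cast
  rfl

theorem partialWeight_zero (x : Marks) : partialWeight 0 x = 0 := by simp [partialWeight]

/-- This is R = Q + ∑ C_i R_i cut off at finitely many generations. Moments then obey a recursion in
`n` that starts from zero, which excludes the spurious solution ∞. -/
theorem partialWeight_succ (n : ℕ) (x : Marks) :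
    partialWeight (n + 1) x = x (.inr (.inl [])) + ∑ i ∈ Finset.Icc 1 (x.offspring []),
      (x.subtree i (.inr (.inr [])) : ℝ≥0∞) * partialWeight n (x.subtree i) := by
  rw [partialWeight, Finset.sum_range_succ', genWeight_zero, add_comm]
  congr 1
  simp_rw [genWeight_succ, partialWeight, Finset.mul_sum]
  rw [Finset.sum_comm]

theorem total_eq_tsum (x : Marks) : total x = ∑' n, genWeight n x := rfl

theorem le_total (x : Marks) : (x (.inr (.inl [])) : ℝ≥0∞) ≤ total x := by
  rw [total_eq_tsum, ← genWeight_zero]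
  exact ENNReal.le_tsum 0

theorem subtree_mul_total_le {x : Marks} {i : ℕ} (hi : i ∈ Finset.Icc 1 (x.offspring [])) :
    (x.subtree i (.inr (.inr [])) : ℝ≥0∞) * total (x.subtree i) ≤ total x := by
  rw [total_eq_tsum, total_eq_tsum, ← ENNReal.tsum_mul_left]
  calc _ ≤ ∑' n, genWeight (n + 1) x := ENNReal.tsum_le_tsum fun n => by
        rw [genWeight_succ]
        exact Finset.single_le_sum
          (f := fun i => (x.subtree i (.inr (.inr [])) : ℝ≥0∞) * genWeight n (x.subtree i))
          (fun _ _ => by positivity) hi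
    _ ≤ _ := ENNReal.tsum_comp_le_tsum_of_injective (add_left_injective 1) _

/-- The number of terms is discrete, so joint measurability can be checked for each fixed number. -/
theorem measurable_sum_Icc {E : Type*} [MeasurableSpace E] {n : E → ℕ} (hn : Measurable n)
    {f : ℕ → E → ℝ≥0∞} (hf : ∀ i, Measurable (f i)) :
    Measurable fun x => ∑ i ∈ Finset.Icc 1 (n x), f i x := by
  have : Measurable fun p : ℕ × E => ∑ i ∈ Finset.Icc 1 p.1, f i p.2 :=
    measurable_from_prod_countable_right fun k =>
      Finset.measurable_fun_sum (Finset.Icc 1 k) fun i _ => hf i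
  exact this.comp (hn.prodMk measurable_id)

theorem measurable_subtree (i : ℕ) : Measurable (subtree i) := by
  unfold subtree
  fun_prop

theorem measurable_offspring (v : List ℕ) : Measurable fun x : Marks => x.offspring v :=
  Nat.measurable_floor.comp (measurable_pi_apply _)

theorem measurable_genWeight (n : ℕ) : Measurable (genWeight n) := by
  induction n with
  | zero =>
    simp_rw [funext genWeight_zero]
    fun_prop
  | succ n ih =>
    rw [funext (genWeight_succ n)]
    refine measurable_sum_Icc (measurable_offspring _) fun i => ?_
    have h := measurable_subtree i
    exact (((measurable_pi_apply _).comp h).coe_nnreal_ennreal).mul (ih.comp h)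

theorem measurable_partialWeight (n : ℕ) : Measurable (partialWeight n) :=
  Finset.measurable_fun_sum _ fun k _ => measurable_genWeight k

theorem measurable_total : Measurable total := by
  rw [funext total_eq_tsum]
  exact Measurable.tsum measurable_genWeight

/-- The weights of the generations do not involve the factor `C` at the root. -/
theorem genWeight_congr {x y : Marks} (h : ∀ j, j ≠ .inr (.inr []) → x j = y j) (n : ℕ) :
    genWeight n x = genWeight n y := by
  cases n with
  | zero => simp only [genWeight_zero, h (.inr (.inl [])) (by simp)]
  | succ n =>
    have hs : ∀ i, subtree i x = subtree i y := fun i => funext fun j => h _ (by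
      rcases j with j | j | j <;> simp [shift])
    have ho : x.offspring [] = y.offspring [] := by
      simp only [offspring, h (.inl []) (by simp)]
    simp only [genWeight_succ, hs, ho]

theorem partialWeight_congr {x y : Marks} (h : ∀ j, j ≠ .inr (.inr []) → x j = y j) (n : ℕ) :
    partialWeight n x = partialWeight n y :=
  Finset.sum_congr rfl fun k _ => genWeight_congr h k

theorem total_congr {x y : Marks} (h : ∀ j, j ≠ .inr (.inr []) → x j = y j) :
    total x = total y := by
  simp only [total_eq_tsum, genWeight_congr h]

end Marks

end BranchingTree

/-! ### Independence of disjoint blocks -/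

namespace ProbabilityTheory.iIndepFun

variable {ι Ω 𝓧 : Type*} [MeasurableSpace 𝓧] [Zero 𝓧] {X : ι → Ω → 𝓧}

/-- Coordinates outside `S` can be replaced by the default value 0 without changing `F`; the
modified family is measurable with respect to the coordinates in `S`. -/
theorem comap_le_iSup_comap {S : Set ι} {β : Type*} [MeasurableSpace β] {F : (ι → 𝓧) → β}
    (hF : Measurable F) (hFS : ∀ x y, (∀ i ∈ S, x i = y i) → F x = F y) :
    MeasurableSpace.comap (fun ω => F fun i => X i ω) inferInstance ≤
      ⨆ i ∈ S, MeasurableSpace.comap (X i) inferInstance := by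
  classical
  have e : (fun ω => F fun i => X i ω) = F ∘ fun ω i => if i ∈ S then X i ω else 0 := by
    funext ω
    exact hFS _ _ fun i hi => by simp [hi]
  rw [e, ← MeasurableSpace.comap_comp]
  refine (MeasurableSpace.comap_mono hF.comap_le).trans ?_
  rw [← measurable_iff_comap_le, @measurable_pi_iff]
  intro i
  by_cases hi : i ∈ S
  · simp only [hi, if_true]
    exact (comap_measurable (X i)).mono
      (le_iSup₂ (f := fun i (_ : i ∈ S) => MeasurableSpace.comap (X i) inferInstance) i hi) le_rfl
  · simp only [hi, if_false]
    exact @measurable_const _ _ _ _ _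

/-- Functions of disjoint blocks of independent variables are independent. -/
theorem indepFun_of_dependsOn [MeasurableSpace Ω] {P : Measure Ω} (h : iIndepFun X P)
    (hX : ∀ i, Measurable (X i)) {S T : Set ι}
    (hST : Disjoint S T) {β γ : Type*} [MeasurableSpace β] [MeasurableSpace γ]
    {F : (ι → 𝓧) → β} {G : (ι → 𝓧) → γ} (hF : Measurable F) (hG : Measurable G)
    (hFS : ∀ x y, (∀ i ∈ S, x i = y i) → F x = F y)
    (hGT : ∀ x y, (∀ i ∈ T, x i = y i) → G x = G y) :
    IndepFun (fun ω => F fun i => X i ω) (fun ω => G fun i => X i ω) P := by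
  rw [IndepFun_iff_Indep]
  exact indep_of_indep_of_le_right (indep_of_indep_of_le_left
    (indep_iSup_of_disjoint (fun i => (hX i).comap_le) h hST) (comap_le_iSup_comap hF hFS))
    (comap_le_iSup_comap hG hGT)

end ProbabilityTheory.iIndepFun

/-! ### The random tree and its self-similarity -/

namespace BranchingTree

/-- The marks of the tree as a random element. -/
def marksOf {Ω : Type*} (Nt : List ℕ → Ω → ℕ) (Qt Ct : List ℕ → Ω → ℝ≥0) (ω : Ω) : Marks :=
  Sum.elim (fun v => (Nt v ω : ℝ≥0)) (Sum.elim (fun v => Qt v ω) fun v => Ct v ω)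

/-- Child counts are embedded in `ℝ≥0` so that all marks have one value type; the floor undoes the
embedding. -/
theorem total_marksOf {Ω : Type*} (Nt : List ℕ → Ω → ℕ) (Qt Ct : List ℕ → Ω → ℝ≥0) (ω : Ω) :
    (marksOf Nt Qt Ct ω).total =
      totalWeight (fun v => Nt v ω) (fun v => Qt v ω) fun v => Ct v ω := by
  have e : (marksOf Nt Qt Ct ω).offspring = fun v => Nt v ω :=
    funext fun v => Nat.floor_natCast _
  rw [Marks.total, e]
  rfl

variable {Ω : Type*} [MeasurableSpace Ω] {P : Measure Ω}

/-- A random family of independent marks of the tree, such that the marks of each subtree are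
distributed like those of the tree. -/
structure IsBranching (P : Measure Ω) (X : Ω → Marks) : Prop where
  measurable : ∀ j, Measurable fun ω => X ω j
  indep : iIndepFun (fun j ω => X ω j) P
  identDistrib : ∀ i j, IdentDistrib (fun ω => X ω (Marks.shift i j)) (fun ω => X ω j) P P

theorem IsIIDMarking.isBranching {N : Ω → ℕ} {Q C : Ω → ℝ≥0}
    {Nt : List ℕ → Ω → ℕ} {Qt Ct : List ℕ → Ω → ℝ≥0} (h : IsIIDMarking P N Q C Nt Qt Ct) :
    IsBranching P (marksOf Nt Qt Ct) where
  measurable j := by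
    rcases j with v | v | v
    · exact (measurable_from_top (f := fun n : ℕ => (n : ℝ≥0))).comp (h.measurable_N v)
    · exact h.measurable_Q v
    · exact h.measurable_C v
  indep := by
    convert! h.iIndepFun_marks using 2 with j
    rcases j with v | v | v <;> rfl
  identDistrib i j := by
    rcases j with v | v | v
    · exact ((h.identDistrib_N _).trans (h.identDistrib_N v).symm).comp
        (measurable_from_top (f := fun n : ℕ => (n : ℝ≥0)))
    · exact (h.identDistrib_Q _).trans (h.identDistrib_Q v).symm
    · exact (h.identDistrib_C _).trans (h.identDistrib_C v).symm

namespace IsBranching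

variable {X : Ω → Marks} (h : IsBranching P X)
include h

theorem measurable' : Measurable X := measurable_pi_lambda _ h.measurable

theorem measurable_subtree (i : ℕ) : Measurable fun ω => (X ω).subtree i :=
  (Marks.measurable_subtree i).comp h.measurable'

/-- Each subtree is distributed like the tree. -/
theorem identDistrib_subtree (i : ℕ) : IdentDistrib (fun ω => (X ω).subtree i) X P P where
  aemeasurable_fst := (h.measurable_subtree i).aemeasurable
  aemeasurable_snd := h.measurable'.aemeasurable
  map_eq := by
    -- By independence both laws are products of their marginals, so it suffices to compare
    -- coordinates.
    have h1 := (h.indep.precomp (Marks.shift_injective i)).map_fun_eq_infinitePi_map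
      fun j => h.measurable _
    have h2 := h.indep.map_fun_eq_infinitePi_map h.measurable
    refine h1.trans (Eq.trans ?_ h2.symm)
    congr 1
    funext j
    exact (h.identDistrib i j).map_eq

/-- A subtree is independent of the other ones together with the number of children of the
root. -/
theorem indepFun_subtree (i : ℕ) : IndepFun (fun ω => (X ω).subtree i)
    (fun ω => ((X ω).offspring [], fun j : {j // j ≠ i} => (X ω).subtree j)) P := by
  refine h.indep.indepFun_of_dependsOn (S := Set.range (Marks.shift i))
    (T := (Set.range (Marks.shift i))ᶜ) h.measurable disjoint_compl_right
    (F := fun x : Marks => x.subtree i)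
    (G := fun x : Marks => (x.offspring [], fun j : {j // j ≠ i} => x.subtree j))
    (Marks.measurable_subtree i)
    ((Marks.measurable_offspring _).prodMk
      (measurable_pi_lambda _ fun j => Marks.measurable_subtree j)) ?_ ?_
  · intro x y hxy
    funext j
    exact hxy _ ⟨j, rfl⟩
  · intro x y hxy
    refine Prod.ext ?_ ?_
    · simp only [Marks.offspring]
      rw [hxy]
      rintro ⟨a, ha⟩
      exact Marks.shift_ne_inl_nil i a ha
    · funext j k
      refine hxy _ ?_
      rintro ⟨a, ha⟩
      exact Marks.shift_ne_shift j.2 _ _ ha.symm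

/-- The factor `C` at the root is independent of what does not involve it. -/
theorem indepFun_factor {β : Type*} [MeasurableSpace β] {F : Marks → β} (hF : Measurable F)
    (hc : ∀ x y : Marks, (∀ j, j ≠ .inr (.inr []) → x j = y j) → F x = F y) :
    IndepFun (fun ω => X ω (.inr (.inr []))) (fun ω => F (X ω)) P :=
  h.indep.indepFun_of_dependsOn (S := {.inr (.inr [])}) (T := {.inr (.inr [])}ᶜ) h.measurable
    disjoint_compl_right (F := fun x : Marks => x (.inr (.inr []))) (measurable_pi_apply _) hF
    (fun _ _ hxy => hxy _ rfl) fun _ _ hxy => hc _ _ fun j hj => hxy j hj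

end IsBranching

end BranchingTree

/-! ### Inequalities for powers and recursions -/

namespace ENNReal

/-- With (1 + η)^s = ρ, either b ≤ ηa and a + b ≤ (1 + η)a, or a ≤ η⁻¹b. A coefficient close to 1 on
the main term preserves a strict contraction. -/
theorem exists_add_rpow_le {s : ℝ} (hs : 0 < s) {ρ : ℝ≥0} (hρ : 1 < ρ) :
    ∃ K : ℝ≥0, ∀ a b : ℝ≥0∞, (a + b) ^ s ≤ ρ * a ^ s + K * b ^ s := by
  obtain ⟨η, hη0, hη⟩ : ∃ η : ℝ≥0, 0 < η ∧ (1 + η) ^ s = ρ := by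
    have h1 : 1 < ρ ^ s⁻¹ := NNReal.one_lt_rpow hρ (by positivity)
    refine ⟨ρ ^ s⁻¹ - 1, tsub_pos_of_lt h1, ?_⟩
    rw [add_tsub_cancel_of_le h1.le, NNReal.rpow_inv_rpow hs.ne']
  refine ⟨(1 + η⁻¹) ^ s, fun a b => ?_⟩
  rcases le_total b (η * a) with hb | hb
  · calc (a + b) ^ s ≤ (((1 + η : ℝ≥0) : ℝ≥0∞) * a) ^ s := by
          gcongr
          push_cast
          rw [add_mul, one_mul]
          gcongr
      _ = ρ * a ^ s := by
          rw [ENNReal.mul_rpow_of_nonneg _ _ hs.le, ← ENNReal.coe_rpow_of_nonneg _ hs.le, hη]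
      _ ≤ _ := le_self_add
  · have ha : a ≤ (η⁻¹ : ℝ≥0) * b := by
      calc a = ((η⁻¹ : ℝ≥0) : ℝ≥0∞) * (η * a) := by
            rw [← mul_assoc, ← ENNReal.coe_mul, inv_mul_cancel₀ hη0.ne', ENNReal.coe_one, one_mul]
        _ ≤ _ := by gcongr
    calc (a + b) ^ s ≤ (((1 + η⁻¹ : ℝ≥0) : ℝ≥0∞) * b) ^ s := by
          gcongr
          rw [ENNReal.coe_add, ENNReal.coe_one, add_mul, one_mul, add_comm]
          gcongr
      _ = ((1 + η⁻¹ : ℝ≥0) ^ s : ℝ≥0) * b ^ s := by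
          rw [ENNReal.mul_rpow_of_nonneg _ _ hs.le, ← ENNReal.coe_rpow_of_nonneg _ hs.le]
      _ ≤ _ := le_add_self

theorem rpow_sum_le_sum_rpow {ι : Type*} (s : Finset ι) (f : ι → ℝ≥0∞) {p : ℝ} (hp : 0 < p)
    (hp1 : p ≤ 1) : (∑ i ∈ s, f i) ^ p ≤ ∑ i ∈ s, f i ^ p :=
  Finset.le_sum_of_subadditive (fun a : ℝ≥0∞ => a ^ p) (ENNReal.zero_rpow_of_pos hp).le
    (fun _ _ => ENNReal.rpow_add_le_add_rpow _ _ hp.le hp1) s f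

/-- The bound is the fixed point A / (1 - ρ) of the recursion; since `r 0` lies below it, finiteness
of the later terms comes out of the induction. -/
theorem exists_forall_le_of_le_add_mul {r : ℕ → ℝ≥0∞} {A ρ : ℝ≥0∞} (h0 : r 0 = 0) (hA : A ≠ ∞)
    (hρ : ρ < 1) (h : ∀ n, r (n + 1) ≤ A + ρ * r n) : ∃ B : ℝ≥0∞, B ≠ ∞ ∧ ∀ n, r n ≤ B := by
  have hd : 1 - ρ ≠ 0 := (tsub_pos_of_lt hρ).ne'
  refine ⟨A * (1 - ρ)⁻¹, ENNReal.mul_ne_top hA (ENNReal.inv_ne_top.2 hd), fun n => ?_⟩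
  induction n with
  | zero => simp [h0]
  | succ n ih =>
    calc r (n + 1) ≤ A + ρ * (A * (1 - ρ)⁻¹) := (h n).trans (by gcongr)
      _ = A * ((1 - ρ) * (1 - ρ)⁻¹) + ρ * (A * (1 - ρ)⁻¹) := by
          rw [ENNReal.mul_inv_cancel hd (by finiteness), mul_one]
      _ = A * (1 - ρ)⁻¹ * ((1 - ρ) + ρ) := by ring
      _ = A * (1 - ρ)⁻¹ := by rw [tsub_add_cancel_of_le hρ.le, mul_one]

end ENNReal

namespace BranchingTree

/-! ### Moments of random sums of independent copies -/

/-- `Y 1 + ⋯ + Y N` is a random sum of copies of `Y₀`, each of which is independent of the other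
ones together with the number of terms. -/
structure IsRandomSum {Ω : Type*} [MeasurableSpace Ω] (P : Measure Ω) (N : Ω → ℕ)
    (Y : ℕ → Ω → ℝ≥0∞) (Y₀ : Ω → ℝ≥0∞) : Prop where
  measurable_N : Measurable N
  measurable_Y : ∀ i, Measurable (Y i)
  indepFun : ∀ i, IndepFun (Y i) (fun ω => (N ω, fun j : {j // j ≠ i} => Y j ω)) P
  identDistrib : ∀ i, IdentDistrib (Y i) Y₀ P P

namespace IsRandomSum

variable {Ω : Type*} [MeasurableSpace Ω] {P : Measure Ω} {N : Ω → ℕ} {Y : ℕ → Ω → ℝ≥0∞}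
  {Y₀ : Ω → ℝ≥0∞}

theorem lintegral_sum_Icc (hN : Measurable N) {f : ℕ → Ω → ℝ≥0∞} (hf : ∀ i, Measurable (f i)) :
    ∫⁻ ω, ∑ i ∈ Finset.Icc 1 (N ω), f i ω ∂P =
      ∑' i, ∫⁻ ω, f i ω * {ω | i ∈ Finset.Icc 1 (N ω)}.indicator 1 ω ∂P := by
  have hm : ∀ i, MeasurableSet {ω | i ∈ Finset.Icc 1 (N ω)} := fun i =>
    hN (MeasurableSet.of_discrete (s := {n : ℕ | i ∈ Finset.Icc 1 n}))
  have hfm : ∀ i, Measurable fun ω => f i ω * {ω | i ∈ Finset.Icc 1 (N ω)}.indicator 1 ω :=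
    fun i => (hf i).mul (measurable_one.indicator (hm i))
  rw [← lintegral_tsum fun i => (hfm i).aemeasurable]
  refine lintegral_congr fun ω => ?_
  rw [tsum_eq_sum (s := Finset.Icc 1 (N ω)) fun i hi => by
    rw [Set.indicator_of_notMem (s := {ω | i ∈ Finset.Icc 1 (N ω)}) hi, mul_zero]]
  exact Finset.sum_congr rfl fun i hi => by
    rw [Set.indicator_of_mem (s := {ω | i ∈ Finset.Icc 1 (N ω)}) hi, Pi.one_apply, mul_one]

variable (h : IsRandomSum P N Y Y₀)
include h

/-- A form of Wald's identity: the event i ≤ N and the weight `G i` are jointly independent of `Y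
i`, so every term factors. -/
theorem lintegral_sum_mul {φ : ℝ≥0∞ → ℝ≥0∞} (hφ : Measurable φ) {G : ℕ → Ω → ℝ≥0∞}
    (hG : ∀ i, Measurable (G i)) (hi : ∀ i, IndepFun (Y i) (fun ω => (N ω, G i ω)) P) :
    ∫⁻ ω, ∑ i ∈ Finset.Icc 1 (N ω), φ (Y i ω) * G i ω ∂P =
      (∫⁻ ω, φ (Y₀ ω) ∂P) * ∫⁻ ω, ∑ i ∈ Finset.Icc 1 (N ω), G i ω ∂P := by
  have hφG : ∀ i, Measurable fun ω => φ (Y i ω) * G i ω :=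
    fun i => (hφ.comp (h.measurable_Y i)).mul (hG i)
  rw [lintegral_sum_Icc h.measurable_N hφG,
    lintegral_sum_Icc h.measurable_N hG, ← ENNReal.tsum_mul_left]
  refine tsum_congr fun i => ?_
  have hψ : Measurable fun p : ℕ × ℝ≥0∞ => p.2 * {n : ℕ | i ∈ Finset.Icc 1 n}.indicator 1 p.1 :=
    measurable_snd.mul ((measurable_one.indicator MeasurableSet.of_discrete).comp measurable_fst)
  have h1 := lintegral_mul_eq_lintegral_mul_lintegral_of_indepFun
    (hφ.comp (h.measurable_Y i)) (hψ.comp (h.measurable_N.prodMk (hG i))) ((hi i).comp hφ hψ)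
  have h2 := ((h.identDistrib i).comp hφ).lintegral_eq
  simp only [Function.comp_apply] at h2
  rw [← h2]
  simp_rw [mul_assoc]
  exact h1

theorem indepFun_prodMk (i : ℕ) {β : Type*} [MeasurableSpace β]
    {g : ℕ × ({j // j ≠ i} → ℝ≥0∞) → β} (hg : Measurable g) :
    IndepFun (Y i) (fun ω => (N ω, g (N ω, fun j => Y j ω))) P :=
  (h.indepFun i).comp measurable_id (measurable_fst.prodMk hg)

theorem lintegral_mul_sum {φ : ℝ≥0∞ → ℝ≥0∞} (hφ : Measurable φ) (g : ℕ → ℝ≥0∞) :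
    ∫⁻ ω, g (N ω) * ∑ i ∈ Finset.Icc 1 (N ω), φ (Y i ω) ∂P =
      (∫⁻ ω, φ (Y₀ ω) ∂P) * ∫⁻ ω, N ω * g (N ω) ∂P := by
  have hg : Measurable g := measurable_from_top
  have := h.lintegral_sum_mul hφ (G := fun _ ω => g (N ω)) (fun i => hg.comp h.measurable_N)
    fun i => h.indepFun_prodMk i (g := fun p => g p.1) (hg.comp measurable_fst)
  simp only [Finset.sum_const, Nat.card_Icc, Nat.add_sub_cancel, nsmul_eq_mul] at this
  rw [← this]
  refine lintegral_congr fun ω => ?_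
  rw [Finset.mul_sum]
  exact Finset.sum_congr rfl fun i _ => mul_comm _ _

theorem lintegral_sum {φ : ℝ≥0∞ → ℝ≥0∞} (hφ : Measurable φ) :
    ∫⁻ ω, ∑ i ∈ Finset.Icc 1 (N ω), φ (Y i ω) ∂P =
      (∫⁻ ω, φ (Y₀ ω) ∂P) * ∫⁻ ω, N ω ∂P := by
  simpa using h.lintegral_mul_sum hφ fun _ => 1

theorem measurable_sum : Measurable fun ω => ∑ i ∈ Finset.Icc 1 (N ω), Y i ω :=
  Marks.measurable_sum_Icc h.measurable_N h.measurable_Y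

/-- With S the sum, S^β = ∑ Y_i S^(β-1). Splitting S into Y_i and the remaining terms, `hK` yields ρ
Y_i^β plus K Y_i times a power of the remainder. The remainder is independent of Y_i, so the
expectation factors, after which it is bounded by S. -/
theorem lintegral_rpow_sum_le {β : ℝ} (hβ : 1 < β) {ρ K : ℝ≥0}
    (hK : ∀ a b : ℝ≥0∞, (a + b) ^ (β - 1) ≤ ρ * a ^ (β - 1) + K * b ^ (β - 1)) :
    ∫⁻ ω, (∑ i ∈ Finset.Icc 1 (N ω), Y i ω) ^ β ∂P ≤
      ρ * ((∫⁻ ω, Y₀ ω ^ β ∂P) * ∫⁻ ω, N ω ∂P) +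
      K * ((∫⁻ ω, Y₀ ω ∂P) *
        ∫⁻ ω, N ω * (∑ i ∈ Finset.Icc 1 (N ω), Y i ω) ^ (β - 1) ∂P) := by
  have hN := h.measurable_N
  have hY := h.measurable_Y
  have hsub : ∀ i, Measurable fun p : ℕ × ({j // j ≠ i} → ℝ≥0∞) =>
      (∑ j ∈ Finset.Icc 1 p.1, if hj : j ≠ i then p.2 ⟨j, hj⟩ else 0) ^ (β - 1) := fun i => by
    refine (Marks.measurable_sum_Icc measurable_fst fun j => ?_).pow_const _
    split_ifs with hj
    · exact (measurable_pi_apply _).comp measurable_snd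
    · exact measurable_const
  let G : ℕ → Ω → ℝ≥0∞ := fun i ω =>
    (∑ j ∈ Finset.Icc 1 (N ω), if j ≠ i then Y j ω else 0) ^ (β - 1)
  have hG : ∀ i, Measurable (G i) := fun i =>
    (hsub i).comp (hN.prodMk (measurable_pi_lambda _ fun j => hY j))
  have e1 := h.lintegral_sum_mul measurable_id hG fun i => h.indepFun_prodMk i (hsub i)
  have e2 := h.lintegral_sum (φ := fun y => y ^ β) (by fun_prop)
  have hsplit : ∀ x : ℝ≥0∞, x ^ β = x * x ^ (β - 1) := fun x => by
    conv_rhs => rw [← ENNReal.rpow_one x, ← ENNReal.rpow_mul, one_mul,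
      ← ENNReal.rpow_add_of_nonneg _ _ zero_le_one (by linarith)]
    ring_nf
  have hpt : ∀ ω, (∑ i ∈ Finset.Icc 1 (N ω), Y i ω) ^ β ≤
      ρ * ∑ i ∈ Finset.Icc 1 (N ω), Y i ω ^ β + K * ∑ i ∈ Finset.Icc 1 (N ω), Y i ω * G i ω := by
    intro ω
    rw [hsplit, Finset.sum_mul, Finset.mul_sum, Finset.mul_sum, ← Finset.sum_add_distrib]
    refine Finset.sum_le_sum fun i hi => ?_
    have : ∑ j ∈ Finset.Icc 1 (N ω), Y j ω =
        Y i ω + ∑ j ∈ Finset.Icc 1 (N ω), if j ≠ i then Y j ω else 0 := by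
      rw [← Finset.add_sum_erase _ _ hi, ← Finset.sum_filter, Finset.filter_ne']
    rw [this]
    calc _ ≤ Y i ω * (ρ * Y i ω ^ (β - 1) + K * G i ω) := by gcongr; exact hK _ _
      _ = _ := by rw [hsplit]; ring
  calc _ ≤ ∫⁻ ω, (ρ * ∑ i ∈ Finset.Icc 1 (N ω), Y i ω ^ β +
        K * ∑ i ∈ Finset.Icc 1 (N ω), Y i ω * G i ω) ∂P := lintegral_mono hpt
    _ = ρ * ((∫⁻ ω, Y₀ ω ^ β ∂P) * ∫⁻ ω, N ω ∂P) +
        K * ((∫⁻ ω, Y₀ ω ∂P) * ∫⁻ ω, ∑ i ∈ Finset.Icc 1 (N ω), G i ω ∂P) := by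
      rw [lintegral_add_left, lintegral_const_mul, lintegral_const_mul, e2]
      · simp only [id] at e1
        rw [e1]
      · exact Marks.measurable_sum_Icc hN fun i => (hY i).mul (hG i)
      · exact Marks.measurable_sum_Icc hN fun i => (hY i).pow_const _
      · exact (Marks.measurable_sum_Icc hN fun i => (hY i).pow_const _).const_mul _
    _ ≤ _ := by
      gcongr with ω
      calc _ ≤ ∑ i ∈ Finset.Icc 1 (N ω), (∑ i ∈ Finset.Icc 1 (N ω), Y i ω) ^ (β - 1) := by
            refine Finset.sum_le_sum fun i _ => ?_
            refine ENNReal.rpow_le_rpow (Finset.sum_le_sum fun j _ => ?_) (by linarith)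
            split_ifs <;> simp
        _ = _ := by simp

/-- For β ≤ 2, N S^(β-1) is at most N^β when S ≤ N and at most N^(β-1) S otherwise. For β ≥ 2, the
power mean inequality gives N^(β-1) ∑ Y_i^(β-1). Summing over the terms contributes one more factor
N, hence E[N^β]. -/
theorem lintegral_mul_rpow_sum_le [IsProbabilityMeasure P] {β : ℝ} (hβ : 1 < β) :
    ∫⁻ ω, N ω * (∑ i ∈ Finset.Icc 1 (N ω), Y i ω) ^ (β - 1) ∂P ≤
      (∫⁻ ω, (N ω : ℝ≥0∞) ^ β ∂P) * (1 + ∫⁻ ω, Y₀ ω ^ max 1 (β - 1) ∂P) := by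
  have hNm : ∀ p : ℝ, Measurable fun ω => (N ω : ℝ≥0∞) ^ p := fun p =>
    (measurable_from_top (f := fun n : ℕ => (n : ℝ≥0∞) ^ p)).comp h.measurable_N
  have hsplit : ∀ (n : ℕ) (p : ℝ), 0 ≤ p → (n : ℝ≥0∞) * (n : ℝ≥0∞) ^ p = (n : ℝ≥0∞) ^ (1 + p) :=
    fun n p hp => by rw [ENNReal.rpow_add_of_nonneg _ _ zero_le_one hp, ENNReal.rpow_one]
  rcases le_total β 2 with h2 | h2
  · rw [max_eq_left (by linarith)]
    have hpt : ∀ (n : ℕ) (s : ℝ≥0∞), n * s ^ (β - 1) ≤ (n : ℝ≥0∞) ^ β + (n : ℝ≥0∞) ^ (β - 1) * s := by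
      intro n s
      rcases Nat.eq_zero_or_pos n with rfl | hn
      · simp
      rcases eq_or_ne s ∞ with rfl | hs
      · have : (n : ℝ≥0∞) ^ (β - 1) ≠ 0 := by
          rw [Ne, ENNReal.rpow_eq_zero_iff]
          simp [hn.ne']
        rw [ENNReal.mul_top this]
        simp
      rcases le_total s n with hsn | hsn
      · refine le_add_right ?_
        calc n * s ^ (β - 1) ≤ n * (n : ℝ≥0∞) ^ (β - 1) := by gcongr
          _ = _ := by rw [hsplit _ _ (by linarith)]; ring_nf
      · refine le_add_left ?_
        have hs0 : s ≠ 0 := fun h0 => by simp [h0, hn.ne'] at hsn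
        have hn0 : (n : ℝ≥0∞) ≠ 0 := by simp [hn.ne']
        have hn1 : (n : ℝ≥0∞) ≠ ∞ := by simp
        calc n * s ^ (β - 1) = (n : ℝ≥0∞) ^ (β - 1) * ((n : ℝ≥0∞) ^ (2 - β) * s ^ (β - 1)) := by
              rw [← mul_assoc, ← ENNReal.rpow_add _ _ hn0 hn1, sub_add_sub_cancel',
                show (2 : ℝ) - 1 = 1 by norm_num, ENNReal.rpow_one]
          _ ≤ (n : ℝ≥0∞) ^ (β - 1) * (s ^ (2 - β) * s ^ (β - 1)) := by gcongr
          _ = _ := by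
              rw [← ENNReal.rpow_add _ _ hs0 hs]
              ring_nf
              rw [ENNReal.rpow_one]
    calc _ ≤ ∫⁻ ω, ((N ω : ℝ≥0∞) ^ β +
          (N ω : ℝ≥0∞) ^ (β - 1) * ∑ i ∈ Finset.Icc 1 (N ω), Y i ω) ∂P :=
          lintegral_mono fun ω => hpt _ _
      _ = (∫⁻ ω, (N ω : ℝ≥0∞) ^ β ∂P) + (∫⁻ ω, Y₀ ω ∂P) * ∫⁻ ω, (N ω : ℝ≥0∞) ^ β ∂P := by
          rw [lintegral_add_left (hNm β)]
          have := h.lintegral_mul_sum measurable_id fun n => (n : ℝ≥0∞) ^ (β - 1)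
          simp only [id] at this
          rw [this]
          simp_rw [hsplit _ (β - 1) (by linarith)]
          ring_nf
      _ = _ := by
          simp_rw [ENNReal.rpow_one]
          ring
  · rw [max_eq_right (by linarith)]
    calc _ ≤ ∫⁻ ω, (N ω : ℝ≥0∞) ^ (β - 1) *
          ∑ i ∈ Finset.Icc 1 (N ω), Y i ω ^ (β - 1) ∂P := by
          refine lintegral_mono fun ω => ?_
          have := ENNReal.rpow_sum_le_const_mul_sum_rpow (Finset.Icc 1 (N ω)) (fun i => Y i ω)
            (p := β - 1) (by linarith)
          simp only [Nat.card_Icc, Nat.add_sub_cancel] at this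
          calc _ ≤ N ω * ((N ω : ℝ≥0∞) ^ (β - 1 - 1) *
                ∑ i ∈ Finset.Icc 1 (N ω), Y i ω ^ (β - 1)) := by gcongr
            _ = _ := by
              rw [← mul_assoc, hsplit _ _ (by linarith)]
              ring_nf
      _ = (∫⁻ ω, Y₀ ω ^ (β - 1) ∂P) * ∫⁻ ω, (N ω : ℝ≥0∞) ^ β ∂P := by
          rw [h.lintegral_mul_sum (φ := fun y => y ^ (β - 1)) (by fun_prop)
            fun n => (n : ℝ≥0∞) ^ (β - 1)]
          simp_rw [hsplit _ (β - 1) (by linarith)]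
          ring_nf
      _ ≤ _ := by
          rw [mul_comm]
          gcongr
          exact le_add_self

end IsRandomSum

end BranchingTree

/-! ### Finite moments of the total weight -/

namespace BranchingTree.Marks

theorem measurable_factor_mul_partialWeight (n : ℕ) : Measurable fun x : Marks =>
    (x (.inr (.inr [])) : ℝ≥0∞) * partialWeight n x := by
  have := measurable_partialWeight n
  fun_prop

theorem lintegral_total_rpow_le {Ω : Type*} [MeasurableSpace Ω] {P : Measure Ω} {X : Ω → Marks}
    {β : ℝ} (hβ : 0 < β) (hX : Measurable X) {B : ℝ≥0∞}
    (hB : ∀ n, ∫⁻ ω, partialWeight n (X ω) ^ β ∂P ≤ B) :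
    ∫⁻ ω, total (X ω) ^ β ∂P ≤ B := by
  refine le_of_tendsto' (lintegral_tendsto_of_tendsto_of_monotone
    (f := fun n ω => partialWeight n (X ω) ^ β) (fun n =>
      (((measurable_partialWeight n).comp hX).pow_const β).aemeasurable)
    (ae_of_all _ fun ω m n hmn => ?_) (ae_of_all _ fun ω => ?_)) hB
  · refine ENNReal.rpow_le_rpow ?_ hβ.le
    exact Finset.sum_le_sum_of_subset (Finset.range_mono hmn)
  · exact (ENNReal.continuous_rpow_const.tendsto _).comp (ENNReal.tendsto_nat_tsum _)

end BranchingTree.Marks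

namespace BranchingTree.IsBranching

open Marks

variable {Ω : Type*} [MeasurableSpace Ω] {P : Measure Ω} {X : Ω → Marks} (h : IsBranching P X)
include h

theorem isRandomSum {Φ : Marks → ℝ≥0∞} (hΦ : Measurable Φ) :
    IsRandomSum P (fun ω => (X ω).offspring []) (fun i ω => Φ ((X ω).subtree i))
      (fun ω => Φ (X ω)) where
  measurable_N := (measurable_offspring _).comp h.measurable'
  measurable_Y i := hΦ.comp (h.measurable_subtree i)
  indepFun i := (h.indepFun_subtree i).comp (φ := Φ)
    (ψ := fun p : ℕ × ({j // j ≠ i} → Marks) => (p.1, fun j => Φ (p.2 j))) hΦ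
    (measurable_fst.prodMk (measurable_pi_lambda _ fun j =>
      hΦ.comp ((measurable_pi_apply j).comp measurable_snd)))
  identDistrib i := (h.identDistrib_subtree i).comp hΦ

theorem lintegral_factor_mul_partialWeight_rpow {p : ℝ} (hp : 0 < p) (n : ℕ) :
    ∫⁻ ω, ((X ω (.inr (.inr [])) : ℝ≥0∞) * partialWeight n (X ω)) ^ p ∂P =
      (∫⁻ ω, (X ω (.inr (.inr [])) : ℝ≥0∞) ^ p ∂P) *
        ∫⁻ ω, partialWeight n (X ω) ^ p ∂P := by
  simp_rw [ENNReal.mul_rpow_of_nonneg _ _ hp.le]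
  have hm := (measurable_partialWeight n).pow_const p
  exact lintegral_mul_eq_lintegral_mul_lintegral_of_indepFun
    ((h.measurable _).coe_nnreal_ennreal.pow_const p) (hm.comp h.measurable')
    ((h.indepFun_factor hm fun x y hxy => by rw [partialWeight_congr hxy]).comp
      (φ := fun c : ℝ≥0 => (c : ℝ≥0∞) ^ p) (by fun_prop) measurable_id)

/-- Subadditivity of x^β turns the recursion at the root into r(n+1) ≤ E[Q^β] + φ(β) r(n). -/
theorem exists_lintegral_partialWeight_rpow_le_of_le_one {β : ℝ} (hβ : 0 < β) (hβ1 : β ≤ 1)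
    (hq : ∫⁻ ω, (X ω (.inr (.inl [])) : ℝ≥0∞) ^ β ∂P ≠ ∞)
    (hφ : (∫⁻ ω, ((X ω).offspring [] : ℝ≥0∞) ∂P) *
      ∫⁻ ω, (X ω (.inr (.inr [])) : ℝ≥0∞) ^ β ∂P < 1) :
    ∃ B : ℝ≥0∞, B ≠ ∞ ∧ ∀ n, ∫⁻ ω, partialWeight n (X ω) ^ β ∂P ≤ B := by
  refine ENNReal.exists_forall_le_of_le_add_mul ?_ hq hφ fun n => ?_
  · simp [partialWeight_zero, ENNReal.zero_rpow_of_pos hβ]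
  · have hr := h.isRandomSum (measurable_factor_mul_partialWeight n)
    have e := hr.lintegral_sum (φ := fun y => y ^ β) (by fun_prop)
    rw [h.lintegral_factor_mul_partialWeight_rpow hβ] at e
    calc ∫⁻ ω, partialWeight (n + 1) (X ω) ^ β ∂P
        ≤ ∫⁻ ω, ((X ω (.inr (.inl [])) : ℝ≥0∞) ^ β +
          ∑ i ∈ Finset.Icc 1 ((X ω).offspring []), (((X ω).subtree i (.inr (.inr [])) : ℝ≥0∞) *
            partialWeight n ((X ω).subtree i)) ^ β) ∂P := by
          refine lintegral_mono fun ω => ?_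
          simp only [partialWeight_succ]
          refine (ENNReal.rpow_add_le_add_rpow _ _ hβ.le hβ1).trans ?_
          gcongr
          exact ENNReal.rpow_sum_le_sum_rpow _ _ hβ hβ1
      _ = _ := by
          rw [lintegral_add_left ((h.measurable _).coe_nnreal_ennreal.pow_const β), e]
          ring

/-- Separating Q from the sum, and then each term from the remaining ones, costs a factor ρ each
time; the recursion contracts if ρ²φ(β) < 1. The cross terms are bounded uniformly in `n` by the
moments in `hm`. -/
theorem exists_lintegral_partialWeight_rpow_le_of_one_lt [IsProbabilityMeasure P] {β : ℝ}
    (hβ : 1 < β)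
    (hq : ∫⁻ ω, (X ω (.inr (.inl [])) : ℝ≥0∞) ^ β ∂P ≠ ∞)
    (hN : ∫⁻ ω, ((X ω).offspring [] : ℝ≥0∞) ^ β ∂P ≠ ∞)
    (hφ : (∫⁻ ω, ((X ω).offspring [] : ℝ≥0∞) ∂P) *
      ∫⁻ ω, (X ω (.inr (.inr [])) : ℝ≥0∞) ^ β ∂P < 1)
    (hc : ∫⁻ ω, (X ω (.inr (.inr [])) : ℝ≥0∞) ^ max 1 (β - 1) ∂P ≠ ∞)
    (hm : ∃ B : ℝ≥0∞, B ≠ ∞ ∧ ∀ n, ∫⁻ ω, partialWeight n (X ω) ^ max 1 (β - 1) ∂P ≤ B) :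
    ∃ B : ℝ≥0∞, B ≠ ∞ ∧ ∀ n, ∫⁻ ω, partialWeight n (X ω) ^ β ∂P ≤ B := by
  obtain ⟨B, hB, hm⟩ := hm
  set N : Ω → ℕ := fun ω => (X ω).offspring [] with hN_def
  set c : Ω → ℝ≥0∞ := fun ω => X ω (.inr (.inr [])) with hc_def
  set φ : ℝ≥0∞ := (∫⁻ ω, (N ω : ℝ≥0∞) ∂P) * ∫⁻ ω, c ω ^ β ∂P with hφ_def
  set p := max 1 (β - 1) with hp
  have hp1 : 1 ≤ p := le_max_left _ _
  obtain ⟨ρ, hρ1, hρ⟩ : ∃ ρ : ℝ≥0, 1 < ρ ∧ (ρ : ℝ≥0∞) * (ρ * φ) < 1 := by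
    lift φ to ℝ≥0 using hφ.ne_top with f
    have hf : f < 1 := by exact_mod_cast hφ
    -- With d = 1 - f, one has (1 + d/4)²(1 - d) < 1 for 0 < d ≤ 1.
    refine ⟨1 + (1 - f) / 4, ?_, ?_⟩
    · have : 0 < 1 - f := tsub_pos_of_lt hf
      exact lt_add_of_pos_right _ (by positivity)
    · norm_cast
      rw [← NNReal.coe_lt_coe]
      push_cast [hf.le]
      have : (f : ℝ) < 1 := hf
      nlinarith [f.2, sq_nonneg (1 - (f : ℝ))]
  obtain ⟨K₁, hK₁⟩ := ENNReal.exists_add_rpow_le (s := β) (by linarith) hρ1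
  obtain ⟨K₂, hK₂⟩ := ENNReal.exists_add_rpow_le (s := β - 1) (by linarith) hρ1
  set M : ℝ≥0∞ := (∫⁻ ω, c ω ^ p ∂P) * B with hM
  have hMtop : M ≠ ∞ := ENNReal.mul_ne_top hc hB
  refine ENNReal.exists_forall_le_of_le_add_mul
    (A := K₁ * (∫⁻ ω, (X ω (.inr (.inl [])) : ℝ≥0∞) ^ β ∂P) +
      ρ * (K₂ * ((1 + M) * ((∫⁻ ω, (N ω : ℝ≥0∞) ^ β ∂P) * (1 + M)))))
    (ρ := ρ * (ρ * φ)) ?_ (by finiteness) hρ fun n => ?_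
  · simp [partialWeight_zero, ENNReal.zero_rpow_of_pos (zero_lt_one.trans hβ)]
  have hr := h.isRandomSum (measurable_factor_mul_partialWeight n)
  have e1 := hr.lintegral_rpow_sum_le hβ hK₂
  have e2 := hr.lintegral_mul_rpow_sum_le hβ
  have e3 : ∫⁻ ω, (c ω * partialWeight n (X ω)) ^ p ∂P ≤ M := by
    rw [h.lintegral_factor_mul_partialWeight_rpow (by linarith)]
    exact mul_le_mul_right (hm n) _
  have e4 : ∫⁻ ω, c ω * partialWeight n (X ω) ∂P ≤ 1 + M := by
    calc _ ≤ ∫⁻ ω, (1 + (c ω * partialWeight n (X ω)) ^ p) ∂P := by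
          refine lintegral_mono fun ω => ?_
          rcases le_total (c ω * partialWeight n (X ω)) 1 with h1 | h1
          · exact h1.trans le_self_add
          · exact (ENNReal.le_rpow_self_of_one_le h1 hp1).trans le_add_self
      _ ≤ _ := by
          rw [lintegral_add_left measurable_const]
          simp only [lintegral_const, measure_univ, mul_one]
          gcongr
  have e5 := h.lintegral_factor_mul_partialWeight_rpow (p := β) (by linarith) n
  rw [e5] at e1
  calc ∫⁻ ω, partialWeight (n + 1) (X ω) ^ β ∂P
      ≤ ∫⁻ ω, (K₁ * (X ω (.inr (.inl [])) : ℝ≥0∞) ^ β +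
        ρ * (∑ i ∈ Finset.Icc 1 (N ω), ((X ω).subtree i (.inr (.inr [])) : ℝ≥0∞) *
          partialWeight n ((X ω).subtree i)) ^ β) ∂P := by
        refine lintegral_mono fun ω => ?_
        simp only [partialWeight_succ]
        rw [add_comm, add_comm (_ * _)]
        exact hK₁ _ _
    _ = K₁ * (∫⁻ ω, (X ω (.inr (.inl [])) : ℝ≥0∞) ^ β ∂P) + ρ *
        ∫⁻ ω, (∑ i ∈ Finset.Icc 1 (N ω), ((X ω).subtree i (.inr (.inr [])) : ℝ≥0∞) *
          partialWeight n ((X ω).subtree i)) ^ β ∂P := by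
        rw [lintegral_add_left, lintegral_const_mul, lintegral_const_mul]
        · exact hr.measurable_sum.pow_const β
        · exact (h.measurable _).coe_nnreal_ennreal.pow_const β
        · exact ((h.measurable _).coe_nnreal_ennreal.pow_const β).const_mul _
    _ ≤ K₁ * (∫⁻ ω, (X ω (.inr (.inl [])) : ℝ≥0∞) ^ β ∂P) + ρ * (ρ *
        ((∫⁻ ω, c ω ^ β ∂P) * (∫⁻ ω, partialWeight n (X ω) ^ β ∂P) * ∫⁻ ω, N ω ∂P) +
        K₂ * ((1 + M) * ((∫⁻ ω, (N ω : ℝ≥0∞) ^ β ∂P) * (1 + M)))) := by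
        gcongr
        refine e1.trans ?_
        gcongr
        refine e2.trans ?_
        gcongr
    _ = _ := by
        rw [hφ_def]
        ring

/-- Exponents are treated in blocks of length one: γ ≤ k + 2 requires only the exponent max(1, γ -
1) ≤ k + 1. -/
theorem exists_lintegral_partialWeight_rpow_le [IsProbabilityMeasure P] {β : ℝ} (hβ : 1 ≤ β)
    (hq : ∀ γ, 1 ≤ γ → γ ≤ β → ∫⁻ ω, (X ω (.inr (.inl [])) : ℝ≥0∞) ^ γ ∂P ≠ ∞)
    (hN : ∀ γ, 1 ≤ γ → γ ≤ β → ∫⁻ ω, ((X ω).offspring [] : ℝ≥0∞) ^ γ ∂P ≠ ∞)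
    (hc : ∀ γ, 1 ≤ γ → γ ≤ β → ∫⁻ ω, (X ω (.inr (.inr [])) : ℝ≥0∞) ^ γ ∂P ≠ ∞)
    (hφ : ∀ γ, 1 ≤ γ → γ ≤ β → (∫⁻ ω, ((X ω).offspring [] : ℝ≥0∞) ∂P) *
      ∫⁻ ω, (X ω (.inr (.inr [])) : ℝ≥0∞) ^ γ ∂P < 1) :
    ∃ B : ℝ≥0∞, B ≠ ∞ ∧ ∀ n, ∫⁻ ω, partialWeight n (X ω) ^ β ∂P ≤ B := by
  have key : ∀ k : ℕ, ∀ γ : ℝ, 1 ≤ γ → γ ≤ k + 1 → γ ≤ β →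
      ∃ B : ℝ≥0∞, B ≠ ∞ ∧ ∀ n, ∫⁻ ω, partialWeight n (X ω) ^ γ ∂P ≤ B := by
    intro k
    induction k with
    | zero =>
      intro γ h1 h2 h3
      exact h.exists_lintegral_partialWeight_rpow_le_of_le_one (by linarith) (by simpa using h2)
        (hq γ h1 h3) (hφ γ h1 h3)
    | succ k ih =>
      intro γ h1 h2 h3
      rcases h1.eq_or_lt with rfl | h1'
      · exact ih 1 le_rfl (by linarith [(Nat.cast_nonneg k : (0 : ℝ) ≤ k)]) h3
      push_cast at h2
      have hp1 : 1 ≤ max 1 (γ - 1) := le_max_left _ _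
      have hp2 : max 1 (γ - 1) ≤ β := max_le hβ (by linarith)
      exact h.exists_lintegral_partialWeight_rpow_le_of_one_lt h1' (hq γ h1 h3) (hN γ h1 h3)
        (hφ γ h1 h3) (hc _ hp1 hp2) (ih _ hp1
          (max_le (by linarith [(Nat.cast_nonneg k : (0 : ℝ) ≤ k)]) (by linarith)) hp2)
  exact key ⌈β⌉₊ β hβ (by linarith [Nat.le_ceil β]) le_rfl

end BranchingTree.IsBranching

/-! ### Comparison principle for lower tail bounds -/

/-- A comparison principle: a positive antitone function that dominates, beyond some point, a
supercritical average of its earlier and later values decays at most like a power. -/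
theorem Real.exists_mul_rpow_neg_le_of_step {g : ℝ → ℝ} (hanti : Antitone g)
    (hpos : ∀ t, 0 < g t) {β γ t₀ L ρ : ℝ} (hβγ : β < γ) (hγ : 0 < γ) (ht₀ : 0 < t₀)
    (hL : 0 < L) (hρ : 1 < ρ)
    (hstep : ∀ t, t₀ ≤ t → ∀ A B : ℝ, 0 ≤ A → 0 ≤ B →
      (∀ s, t / L ≤ s → A * s ^ (-γ) ≤ g s + B * s ^ (-β)) →
      ρ * (A * t ^ (-γ)) ≤ g t + ρ * (B * t ^ (-β))) :
    ∃ c, 0 < c ∧ ∀ t, t₀ ≤ t → c * t ^ (-γ) ≤ g t := by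
  set s₀ := t₀ / L with hs₀
  have hs₀pos : 0 < s₀ := by positivity
  set c₀ := g t₀ * s₀ ^ γ with hc₀
  have hc₀pos : 0 < c₀ := mul_pos (hpos _) (by positivity)
  have hbd : ∀ s, s₀ ≤ s → s₀ ^ γ * s ^ (-γ) ≤ 1 := fun s hs => by
    have h0 : 0 < s := hs₀pos.trans_le hs
    rw [Real.rpow_neg h0.le, ← div_eq_mul_inv]
    exact div_le_one_of_le₀ (Real.rpow_le_rpow hs₀pos.le hs hγ.le) (by positivity)
  -- The difference changes sign at T, so beyond T the inequality is trivial. The essential point is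
  -- that c₀ does not depend on T.
  have key : ∀ T, 0 < T → ∀ s, s₀ ≤ s →
      c₀ * (s ^ (-γ) - T ^ (β - γ) * s ^ (-β)) ≤ g s := by
    intro T hT
    set u : ℝ → ℝ := fun s => s ^ (-γ) - T ^ (β - γ) * s ^ (-β) with hu
    have hmono : ∀ s μ ν, 0 ≤ μ → μ ≤ ν → ν * u s ≤ g s → μ * u s ≤ g s := by
      intro s μ ν hμ hμν h
      rcases le_total (u s) 0 with h0 | h0
      · exact (mul_nonpos_of_nonneg_of_nonpos hμ h0).trans (hpos s).le
      · exact (mul_le_mul_of_nonneg_right hμν h0).trans h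
    have hule : ∀ s, s₀ ≤ s → u s ≤ s ^ (-γ) := fun s hs => by
      have h0 : 0 < s := hs₀pos.trans_le hs
      have : 0 ≤ T ^ (β - γ) * s ^ (-β) := by positivity
      simp only [hu]; linarith
    set ℓ := g T * s₀ ^ γ with hℓ
    have hℓpos : 0 < ℓ := mul_pos (hpos _) (by positivity)
    -- The initial constant ℓ depends on T and grows by a factor ρ at each step. It is capped at c₀,
    -- which is what monotonicity gives on [s₀, t₀], where `hstep` does not apply.
    have hiter : ∀ n : ℕ, ∀ s, s₀ ≤ s → min c₀ (ℓ * ρ ^ n) * u s ≤ g s := by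
      intro n
      induction n with
      | zero =>
        intro s hs
        have h0 : 0 < s := hs₀pos.trans_le hs
        refine hmono s _ ℓ (by positivity) (by simp) ?_
        rcases le_total T s with h1 | h1
        · have h2 : u s ≤ 0 := by
            have e : s ^ (-γ) = s ^ (β - γ) * s ^ (-β) := by
              rw [← Real.rpow_add h0]; ring_nf
            have : s ^ (β - γ) ≤ T ^ (β - γ) :=
              Real.rpow_le_rpow_of_nonpos hT h1 (by linarith)
            simp only [hu]
            rw [e, ← sub_mul]
            exact mul_nonpos_of_nonpos_of_nonneg (by linarith) (by positivity)
          exact (mul_nonpos_of_nonneg_of_nonpos hℓpos.le h2).trans (hpos s).le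
        · calc ℓ * u s ≤ ℓ * s ^ (-γ) := by gcongr; exact hule s hs
            _ = g T * (s₀ ^ γ * s ^ (-γ)) := by rw [hℓ]; ring
            _ ≤ g T * 1 := by have := (hpos T).le; gcongr; exact hbd s hs
            _ ≤ g s := by rw [mul_one]; exact hanti h1
      | succ n ih =>
        intro s hs
        set μ := min c₀ (ℓ * ρ ^ n) with hμ
        have hμ0 : 0 < μ := lt_min hc₀pos (by positivity)
        rcases le_total t₀ s with h1 | h1
        · have := hstep s h1 μ (μ * T ^ (β - γ)) hμ0.le (by positivity) fun r hr => by
            have := ih r ((div_le_div_of_nonneg_right h1 hL.le).trans hr)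
            simp only [hu] at this
            linarith
          refine hmono s _ (μ * ρ) (by positivity) ?_ (by simp only [hu]; linarith)
          rcases min_choice c₀ (ℓ * ρ ^ n) with h | h
          · exact (min_le_left _ _).trans (by rw [hμ, h]; exact le_mul_of_one_le_right hc₀pos.le hρ.le)
          · exact (min_le_right _ _).trans (by rw [hμ, h]; exact (by ring : _ = _).le)
        · refine hmono s _ c₀ (by positivity) (min_le_left _ _) ?_
          calc c₀ * u s ≤ c₀ * s ^ (-γ) := by gcongr; exact hule s hs
            _ = g t₀ * (s₀ ^ γ * s ^ (-γ)) := by rw [hc₀]; ring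
            _ ≤ g t₀ * 1 := by have := (hpos t₀).le; gcongr; exact hbd s hs
            _ ≤ g s := by rw [mul_one]; exact hanti h1
    obtain ⟨n, hn⟩ := pow_unbounded_of_one_lt (c₀ / ℓ) hρ
    intro s hs
    have := hiter n s hs
    rwa [min_eq_left] at this
    rw [div_lt_iff₀ hℓpos] at hn
    linarith
  have h2 : (2 : ℝ) ^ (β - γ) < 1 := Real.rpow_lt_one_of_one_lt_of_neg (by norm_num) (by linarith)
  refine ⟨min (c₀ * (1 - 2 ^ (β - γ))) (g s₀ * t₀ ^ γ),
    lt_min (mul_pos hc₀pos (by linarith)) (mul_pos (hpos _) (by positivity)), fun t ht => ?_⟩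
  have h0 : 0 < t := ht₀.trans_le ht
  rcases le_total s₀ t with h1 | h1
  -- Taking T = 2t makes the subtracted term the fixed fraction 2^(β-γ) < 1 of t^(-γ).
  · have := key (2 * t) (by positivity) t h1
    have e : (2 * t) ^ (β - γ) * t ^ (-β) = 2 ^ (β - γ) * t ^ (-γ) := by
      rw [Real.mul_rpow (by norm_num) h0.le, mul_assoc, ← Real.rpow_add h0]
      ring_nf
    rw [e] at this
    calc _ ≤ c₀ * (1 - 2 ^ (β - γ)) * t ^ (-γ) := by gcongr; exact min_le_left _ _
      _ = _ := by ring
      _ ≤ _ := this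
  -- This case covers t₀ ≤ t ≤ s₀, an interval that is nondegenerate when L < 1.
  · calc _ ≤ g s₀ * t₀ ^ γ * t ^ (-γ) := by gcongr; exact min_le_right _ _
      _ = g s₀ * (t₀ ^ γ / t ^ γ) := by rw [Real.rpow_neg h0.le]; ring
      _ ≤ g s₀ * 1 := by
        have := (hpos s₀).le
        gcongr
        exact div_le_one_of_le₀ (Real.rpow_le_rpow ht₀.le ht hγ.le) (by positivity)
      _ ≤ g t := by rw [mul_one]; exact hanti h1

/-! ### Bonferroni inequality for a random number of terms -/

namespace BranchingTree

namespace IsRandomSum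

variable {Ω : Type*} [MeasurableSpace Ω] {P : Measure Ω} {N : Ω → ℕ} {Y : ℕ → Ω → ℝ≥0∞}
  {Y₀ : Ω → ℝ≥0∞} (h : IsRandomSum P N Y Y₀)
include h

/-- Capping the number of terms bounds the number of pairs by K², so no second moment of N is
needed. -/
theorem min_const (K : ℕ) : IsRandomSum P (fun ω => min (N ω) K) Y Y₀ where
  measurable_N := h.measurable_N.min measurable_const
  measurable_Y := h.measurable_Y
  indepFun i := (h.indepFun i).comp measurable_id
    ((measurable_fst.min measurable_const).prodMk measurable_snd)
  identDistrib := h.identDistrib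

/-- A Bonferroni inequality for the maximum of the terms of a random sum. -/
theorem lintegral_min_mul_measure_le (K : ℕ) (t : ℝ≥0∞) :
    (∫⁻ ω, (min (N ω) K : ℕ) ∂P) * P {ω | t < Y₀ ω} ≤
      P {ω | ∃ i ∈ Finset.Icc 1 (N ω), t < Y i ω} + K ^ 2 * P {ω | t < Y₀ ω} ^ 2 := by
  let φ : ℝ≥0∞ → ℝ≥0∞ := (Set.Ioi t).indicator 1
  have hφ : Measurable φ := measurable_one.indicator measurableSet_Ioi
  have hφ1 : ∀ y, φ y ≤ 1 := fun y => Set.indicator_le_self' (by simp) y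
  have hYφ : ∀ i, Measurable fun ω => φ (Y i ω) := fun i => hφ.comp (h.measurable_Y i)
  have hφY : ∀ i, ∫⁻ ω, φ (Y i ω) ∂P = P {ω | t < Y₀ ω} := fun i => by
    have h1 := (h.identDistrib i).measure_mem_eq (s := Set.Ioi t) measurableSet_Ioi
    rw [← lintegral_map hφ (h.measurable_Y i), lintegral_indicator_one measurableSet_Ioi,
      Measure.map_apply (h.measurable_Y i) measurableSet_Ioi]
    exact h1
  have hset : MeasurableSet {ω | ∃ i ∈ Finset.Icc 1 (N ω), t < Y i ω} := by
    have e : {ω | ∃ i ∈ Finset.Icc 1 (N ω), t < Y i ω} =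
        ⋃ i, {ω | i ∈ Finset.Icc 1 (N ω)} ∩ {ω | t < Y i ω} := by
      ext ω; simp
    rw [e]
    exact MeasurableSet.iUnion fun i =>
      (h.measurable_N (MeasurableSet.of_discrete (s := {n : ℕ | i ∈ Finset.Icc 1 n}))).inter
        (h.measurable_Y i measurableSet_Ioi)
  have e1 := (h.min_const K).lintegral_sum hφ
  have e2 : ∫⁻ ω, φ (Y₀ ω) ∂P = P {ω | t < Y₀ ω} := by
    rw [← hφY 0]; exact (((h.identDistrib 0).comp hφ).lintegral_eq).symm
  have e3 : ∀ i, ∀ j, j ≠ i → ∫⁻ ω, φ (Y i ω) * φ (Y j ω) ∂P = P {ω | t < Y₀ ω} ^ 2 := by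
    intro i j hj
    have hi : IndepFun (Y i) (Y j) P := (h.indepFun i).comp (φ := id)
      (ψ := fun p : ℕ × ({j // j ≠ i} → ℝ≥0∞) => p.2 ⟨j, hj⟩) measurable_id
      ((measurable_pi_apply _).comp measurable_snd)
    have := lintegral_mul_eq_lintegral_mul_lintegral_of_indepFun (hYφ i) (hYφ j)
      (hi.comp hφ hφ)
    rw [hφY, hφY, ← sq] at this
    exact this
  have hYY : ∀ i j, Measurable fun ω => φ (Y i ω) * φ (Y j ω) := fun i j => (hYφ i).mul (hYφ j)
  -- If the i-th term exceeds t, the indicator pays for it, and every other exceedance is paid for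
  -- by its pair with i. The pairs range over the deterministic set {1, …, K}.
  have hpt : ∀ ω, ∑ i ∈ Finset.Icc 1 (min (N ω) K), φ (Y i ω) ≤
      {ω | ∃ i ∈ Finset.Icc 1 (N ω), t < Y i ω}.indicator 1 ω +
        ∑ i ∈ Finset.Icc 1 K, ∑ j ∈ (Finset.Icc 1 K).erase i, φ (Y i ω) * φ (Y j ω) := by
    intro ω
    by_cases hex : ∃ i ∈ Finset.Icc 1 (min (N ω) K), t < Y i ω
    · obtain ⟨i, hi, hti⟩ := hex
      have hiK : i ∈ Finset.Icc 1 K :=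
        Finset.Icc_subset_Icc_right (min_le_right _ _) hi
      have hiN : i ∈ Finset.Icc 1 (N ω) :=
        Finset.Icc_subset_Icc_right (min_le_left _ _) hi
      have hφi : φ (Y i ω) = 1 := Set.indicator_of_mem (s := Set.Ioi t) hti _
      rw [Set.indicator_of_mem (s := {ω | ∃ i ∈ Finset.Icc 1 (N ω), t < Y i ω}) ⟨i, hiN, hti⟩,
        ← Finset.add_sum_erase _ _ hi]
      refine add_le_add (hφ1 _) ?_
      calc ∑ j ∈ (Finset.Icc 1 (min (N ω) K)).erase i, φ (Y j ω)
          ≤ ∑ j ∈ (Finset.Icc 1 K).erase i, φ (Y i ω) * φ (Y j ω) := by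
            simp only [hφi, one_mul]
            exact Finset.sum_le_sum_of_subset (Finset.erase_subset_erase _
              (Finset.Icc_subset_Icc_right (min_le_right _ _)))
        _ ≤ _ := Finset.single_le_sum
            (f := fun i => ∑ j ∈ (Finset.Icc 1 K).erase i, φ (Y i ω) * φ (Y j ω))
            (fun _ _ => by positivity) hiK
    · rw [Finset.sum_eq_zero]
      · positivity
      · intro i hi
        exact Set.indicator_of_notMem (s := Set.Ioi t) (fun hti => hex ⟨i, hi, hti⟩) _
  rw [mul_comm, ← e2, ← e1, e2]
  calc _ ≤ ∫⁻ ω, ({ω | ∃ i ∈ Finset.Icc 1 (N ω), t < Y i ω}.indicator 1 ω +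
        ∑ i ∈ Finset.Icc 1 K, ∑ j ∈ (Finset.Icc 1 K).erase i, φ (Y i ω) * φ (Y j ω)) ∂P :=
        lintegral_mono hpt
    _ = P {ω | ∃ i ∈ Finset.Icc 1 (N ω), t < Y i ω} +
        ∑ i ∈ Finset.Icc 1 K, ∑ j ∈ (Finset.Icc 1 K).erase i, P {ω | t < Y₀ ω} ^ 2 := by
      rw [lintegral_add_left (measurable_one.indicator hset), lintegral_indicator_one hset,
        lintegral_finsetSum _ fun i _ => Finset.measurable_fun_sum _ fun j _ => hYY i j]
      congr 1
      refine Finset.sum_congr rfl fun i _ => ?_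
      rw [lintegral_finsetSum _ fun j _ => hYY i j]
      exact Finset.sum_congr rfl fun j hj => e3 i j (Finset.ne_of_mem_erase hj)
    _ ≤ _ := by
      gcongr
      simp only [Finset.sum_const, nsmul_eq_mul]
      calc ∑ i ∈ Finset.Icc 1 K, (((Finset.Icc 1 K).erase i).card : ℝ≥0∞) * P {ω | t < Y₀ ω} ^ 2
          ≤ ∑ i ∈ Finset.Icc 1 K, (K : ℝ≥0∞) * P {ω | t < Y₀ ω} ^ 2 := by
            gcongr with i hi
            exact (Finset.card_erase_le).trans (by simp)
        _ = _ := by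
            simp only [Finset.sum_const, nsmul_eq_mul, Nat.card_Icc, Nat.add_sub_cancel]
            ring

end IsRandomSum

end BranchingTree

/-! ### Lower bound for the tail -/

namespace BranchingTree

namespace Marks

/-- The contribution of the subtree to the total weight of its parent, when the factor of its root
is at most `L`. -/
noncomputable def truncatedWeight (L : ℝ≥0) (x : Marks) : ℝ≥0∞ :=
  if x (.inr (.inr [])) ≤ L then (x (.inr (.inr [])) : ℝ≥0∞) * total x else 0

theorem measurable_truncatedWeight (L : ℝ≥0) : Measurable (truncatedWeight L) := by
  have := measurable_total
  have h1 : Measurable fun x : Marks => x (.inr (.inr [])) := by fun_prop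
  exact Measurable.ite (h1 measurableSet_Iic) (by fun_prop) measurable_const

theorem truncatedWeight_le (L : ℝ≥0) (x : Marks) : truncatedWeight L x ≤ L * total x := by
  unfold truncatedWeight
  split_ifs with h
  · gcongr
  · exact zero_le

theorem truncatedWeight_subtree_le (L : ℝ≥0) {x : Marks} {i : ℕ}
    (hi : i ∈ Finset.Icc 1 (x.offspring [])) : truncatedWeight L (x.subtree i) ≤ total x := by
  unfold truncatedWeight
  split_ifs
  · exact subtree_mul_total_le hi
  · exact zero_le

end Marks

namespace IsBranching

open Marks

variable {Ω : Type*} [MeasurableSpace Ω] {P : Measure Ω} {X : Ω → Marks} (h : IsBranching P X)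
include h

theorem measurable_total' : Measurable fun ω => total (X ω) := measurable_total.comp h.measurable'

theorem indepFun_factor_total :
    IndepFun (fun ω => X ω (.inr (.inr []))) (fun ω => total (X ω)) P :=
  h.indepFun_factor measurable_total fun _ _ => total_congr

theorem measure_lt_truncatedWeight [IsProbabilityMeasure P] (L : ℝ≥0) (t : ℝ≥0∞) :
    P {ω | t < truncatedWeight L (X ω)} = ∫⁻ ω, P {ω' | t < if X ω (.inr (.inr [])) ≤ L then
      (X ω (.inr (.inr [])) : ℝ≥0∞) * total (X ω') else 0} ∂P := by
  have hc := h.measurable (.inr (.inr []))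
  have hR := h.measurable_total'
  have hS : MeasurableSet {p : ℝ≥0 × ℝ≥0∞ | t < if p.1 ≤ L then (p.1 : ℝ≥0∞) * p.2 else 0} :=
    measurableSet_lt measurable_const (Measurable.ite (measurable_fst measurableSet_Iic)
      (by fun_prop) measurable_const)
  have e := (indepFun_iff_map_prod_eq_prod_map_map hc.aemeasurable hR.aemeasurable).1
    h.indepFun_factor_total
  have e2 := congrArg (fun μ => μ {p : ℝ≥0 × ℝ≥0∞ | t < if p.1 ≤ L then (p.1 : ℝ≥0∞) * p.2 else 0}) e
  have := Measure.isProbabilityMeasure_map (μ := P) hR.aemeasurable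
  rw [Measure.map_apply (hc.prodMk hR) hS, Measure.prod_apply hS,
    lintegral_map (measurable_measure_prodMk_left hS) hc] at e2
  refine e2.trans (lintegral_congr fun ω => ?_)
  rw [Measure.map_apply hR (measurable_prodMk_left hS)]
  rfl

/-- Given C = c with 0 < c ≤ L, the event is R > t/c, and t/c ≥ t/L is in the range of `hs`. The
identity (t/c)^(-p) = t^(-p) c^p then produces truncated moments of C. -/
theorem le_measure_lt_truncatedWeight [IsProbabilityMeasure P] {L : ℝ≥0}
    {β γ A B t : ℝ} (hβ : 0 < β) (hγ : 0 < γ) (ht : 0 < t) (hA : 0 ≤ A) (hB : 0 ≤ B)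
    (hs : ∀ s, t / L ≤ s →
      A * s ^ (-γ) ≤ P.real {ω | ENNReal.ofReal s < total (X ω)} + B * s ^ (-β)) :
    ENNReal.ofReal (A * t ^ (-γ)) * ∫⁻ ω, (if X ω (.inr (.inr [])) ≤ L then
        (X ω (.inr (.inr [])) : ℝ≥0∞) ^ γ else 0) ∂P ≤
      P {ω | ENNReal.ofReal t < truncatedWeight L (X ω)} +
      ENNReal.ofReal (B * t ^ (-β)) * ∫⁻ ω, (if X ω (.inr (.inr [])) ≤ L then
        (X ω (.inr (.inr [])) : ℝ≥0∞) ^ β else 0) ∂P := by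
  have hm : ∀ p : ℝ, Measurable fun ω => if X ω (.inr (.inr [])) ≤ L then
      (X ω (.inr (.inr [])) : ℝ≥0∞) ^ p else 0 := fun p =>
    Measurable.ite (h.measurable _ measurableSet_Iic)
      ((h.measurable _).coe_nnreal_ennreal.pow_const p) measurable_const
  rw [h.measure_lt_truncatedWeight, ← lintegral_const_mul _ (hm γ), ← lintegral_const_mul _ (hm β),
    ← lintegral_add_right _ ((hm β).const_mul _)]
  refine lintegral_mono fun ω => ?_
  dsimp only
  generalize X ω (.inr (.inr [])) = c
  split_ifs with hcL
  swap
  · simp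
  rcases eq_or_ne c 0 with rfl | hc0
  · simp [hγ]
  have hc : 0 < (c : ℝ) := NNReal.coe_pos.2 (pos_iff_ne_zero.2 hc0)
  have h1 := hs (t / c) (div_le_div_of_nonneg_left ht.le hc hcL)
  have hset : {ω' | ENNReal.ofReal (t / c) < total (X ω')} ⊆
      {ω' | ENNReal.ofReal t < c * total (X ω')} := fun ω' hω' => by
    have e : ENNReal.ofReal t = c * ENNReal.ofReal (t / c) := by
      rw [← ENNReal.ofReal_coe_nnreal, ← ENNReal.ofReal_mul hc.le, mul_div_cancel₀ _ hc.ne']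
    change ENNReal.ofReal t < _
    rw [e]
    exact ENNReal.mul_lt_mul_right (by exact_mod_cast hc0) ENNReal.coe_ne_top hω'
  have hpow : ∀ p : ℝ, (t / c) ^ (-p) = t ^ (-p) * (c : ℝ) ^ p := fun p => by
    rw [Real.div_rpow ht.le hc.le, Real.rpow_neg hc.le, div_inv_eq_mul]
  have hcp : ∀ p : ℝ, 0 < p → (c : ℝ≥0∞) ^ p = ENNReal.ofReal ((c : ℝ) ^ p) := fun p hp => by
    rw [← ENNReal.ofReal_rpow_of_pos hc, ENNReal.ofReal_coe_nnreal]
  rw [hpow, hpow] at h1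
  rw [hcp γ hγ, hcp β hβ, ← ENNReal.ofReal_mul (by positivity), ← ENNReal.ofReal_mul (by positivity)]
  calc ENNReal.ofReal (A * t ^ (-γ) * (c : ℝ) ^ γ)
      ≤ ENNReal.ofReal (P.real {ω | ENNReal.ofReal (t / c) < total (X ω)} +
          B * t ^ (-β) * (c : ℝ) ^ β) := by
        refine ENNReal.ofReal_le_ofReal ?_
        linarith
    _ = P {ω | ENNReal.ofReal (t / c) < total (X ω)} +
          ENNReal.ofReal (B * t ^ (-β) * (c : ℝ) ^ β) := by
        rw [ENNReal.ofReal_add (by positivity) (by positivity), ofReal_measureReal]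
    _ ≤ _ := by gcongr

/-- The total weight is unbounded. -/
theorem measure_lt_total_pos [IsProbabilityMeasure P]
    (hq : P {ω | 0 < X ω (.inr (.inl []))} ≠ 0) (hN : P {ω | 0 < (X ω).offspring []} ≠ 0)
    (hc : P {ω | 1 < X ω (.inr (.inr []))} ≠ 0) (t : ℝ) :
    0 < P.real {ω | ENNReal.ofReal t < total (X ω)} := by
  obtain ⟨q, hq0, hq⟩ : ∃ q : ℝ≥0, 0 < q ∧ P {ω | q < X ω (.inr (.inl []))} ≠ 0 := by
    by_contra! hcon
    refine hq (measure_mono_null (fun ω hω => ?_)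
      (measure_iUnion_null fun n : ℕ => hcon ((n : ℝ≥0) + 1)⁻¹ (by positivity)))
    obtain ⟨n, hn⟩ := exists_nat_one_div_lt (K := ℝ≥0) (show 0 < X ω (.inr (.inl [])) from hω)
    exact Set.mem_iUnion.2 ⟨n, by simpa using hn⟩
  obtain ⟨b, hb1, hb⟩ : ∃ b : ℝ≥0, 1 < b ∧ P {ω | b < X ω (.inr (.inr []))} ≠ 0 := by
    by_contra! hcon
    refine hc (measure_mono_null (fun ω hω => ?_)
      (measure_iUnion_null fun n : ℕ => hcon (1 + ((n : ℝ≥0) + 1)⁻¹) (by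
        exact lt_add_of_pos_right _ (by positivity))))
    obtain ⟨n, hn⟩ := exists_nat_one_div_lt (K := ℝ≥0)
      (tsub_pos_of_lt (show 1 < X ω (.inr (.inr [])) from hω))
    refine Set.mem_iUnion.2 ⟨n, ?_⟩
    have := lt_tsub_iff_left.1 hn
    simpa using this
  -- With positive probability the first child exists, has factor above b, and carries a subtree of
  -- weight above s, by independence.
  have hstep : ∀ s : ℝ≥0, P {ω | (s : ℝ≥0∞) < total (X ω)} ≠ 0 →
      P {ω | ((b * s : ℝ≥0) : ℝ≥0∞) < total (X ω)} ≠ 0 := by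
    intro s hs
    let Φ : Marks → ℝ≥0∞ := fun x => (x (.inr (.inr [])) : ℝ≥0∞) * total x
    have hΦ : Measurable Φ := by
      have := measurable_total
      fun_prop
    have h1 : P {ω | ((b * s : ℝ≥0) : ℝ≥0∞) < Φ (X ω)} ≠ 0 := by
      have e := h.indepFun_factor_total.measure_inter_preimage_eq_mul (Set.Ioi b)
        (Set.Ioi (s : ℝ≥0∞)) measurableSet_Ioi measurableSet_Ioi
      intro h0
      refine mul_ne_zero hb hs (e.symm.trans (measure_mono_null ?_ h0))
      rintro ω ⟨hω1, hω2⟩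
      change ((b * s : ℝ≥0) : ℝ≥0∞) < (X ω (.inr (.inr [])) : ℝ≥0∞) * total (X ω)
      rw [ENNReal.coe_mul]
      exact ENNReal.mul_lt_mul (ENNReal.coe_lt_coe.2 hω1) hω2
    have hr := h.isRandomSum hΦ
    have h2 : P {ω | ((b * s : ℝ≥0) : ℝ≥0∞) < Φ ((X ω).subtree 1)} ≠ 0 := by
      have := (hr.identDistrib 1).measure_mem_eq
        (s := Set.Ioi (((b * s : ℝ≥0) : ℝ≥0∞))) measurableSet_Ioi
      exact fun h0 => h1 (this.symm.trans h0)
    have hi : IndepFun (fun ω => Φ ((X ω).subtree 1)) (fun ω => (X ω).offspring []) P :=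
      (hr.indepFun 1).comp measurable_id measurable_fst
    have e := hi.measure_inter_preimage_eq_mul (Set.Ioi (((b * s : ℝ≥0) : ℝ≥0∞)))
      (Set.Ioi 0) measurableSet_Ioi measurableSet_Ioi
    intro h0
    refine mul_ne_zero h2 hN (e.symm.trans (measure_mono_null ?_ h0))
    rintro ω ⟨hω1, hω2⟩
    exact lt_of_lt_of_le hω1 (subtree_mul_total_le (Finset.mem_Icc.2 ⟨le_rfl, hω2⟩))
  have hiter : ∀ n : ℕ, P {ω | ((b ^ n * q : ℝ≥0) : ℝ≥0∞) < total (X ω)} ≠ 0 := by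
    intro n
    induction n with
    | zero =>
      refine fun h0 => hq (measure_mono_null (fun ω hω => ?_) h0)
      have : (q : ℝ≥0∞) < X ω (.inr (.inl [])) := ENNReal.coe_lt_coe.2 hω
      simpa using this.trans_le (le_total _)
    | succ n ih =>
      have := hstep _ ih
      rwa [← mul_assoc, ← pow_succ'] at this
  obtain ⟨n, hn⟩ := pow_unbounded_of_one_lt (t.toNNReal / q) hb1
  refine ENNReal.toReal_pos (fun h0 => hiter n (measure_mono_null (fun ω hω => ?_) h0))
    (measure_ne_top _ _)
  have hω' : ((b ^ n * q : ℝ≥0) : ℝ≥0∞) < total (X ω) := hω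
  refine lt_of_le_of_lt ?_ hω'
  rw [div_lt_iff₀ hq0] at hn
  exact ENNReal.coe_le_coe.2 hn.le

/-- Capping N and C keeps the product at γ above 1 while making the moments finite, even if E[C^γ] =
∞. As the tail tends to 0, the quadratic Bonferroni error becomes a small multiple δ of the linear
term. -/
theorem exists_mul_rpow_neg_le_measure [IsProbabilityMeasure P]
    (hpos : ∀ t, 0 < P.real {ω | ENNReal.ofReal t < total (X ω)})
    (htend : Tendsto (fun t : ℝ => P.real {ω | ENNReal.ofReal t < total (X ω)}) atTop (nhds 0))
    {β γ : ℝ} (hβ : 0 < β) (hβγ : β < γ)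
    (hN : ∫⁻ ω, ((X ω).offspring [] : ℝ≥0∞) ∂P ≠ ∞)
    (hφβ : (∫⁻ ω, ((X ω).offspring [] : ℝ≥0∞) ∂P) *
      ∫⁻ ω, (X ω (.inr (.inr [])) : ℝ≥0∞) ^ β ∂P < 1)
    (hφγ : 1 < (∫⁻ ω, ((X ω).offspring [] : ℝ≥0∞) ∂P) *
      ∫⁻ ω, (X ω (.inr (.inr [])) : ℝ≥0∞) ^ γ ∂P) :
    ∃ c t₀ : ℝ, 0 < c ∧ ∀ t, t₀ ≤ t →
      c * t ^ (-γ) ≤ P.real {ω | ENNReal.ofReal t < total (X ω)} := by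
  have hγ : 0 < γ := hβ.trans hβγ
  set N : Ω → ℕ := fun ω => (X ω).offspring [] with hN_def
  have hNm : Measurable N := (measurable_offspring _).comp h.measurable'
  set I : ℝ≥0 → ℝ → ℝ≥0∞ := fun L p => ∫⁻ ω, (if X ω (.inr (.inr [])) ≤ L then
        (X ω (.inr (.inr [])) : ℝ≥0∞) ^ p else 0) ∂P with hI
  have hm : ∀ (L : ℝ≥0) (p : ℝ), Measurable fun ω => if X ω (.inr (.inr [])) ≤ L then
      (X ω (.inr (.inr [])) : ℝ≥0∞) ^ p else 0 := fun L p =>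
    Measurable.ite (h.measurable _ measurableSet_Iic)
      ((h.measurable _).coe_nnreal_ennreal.pow_const p) measurable_const
  have hNlim : Tendsto (fun K : ℕ => ∫⁻ ω, ((min (N ω) K : ℕ) : ℝ≥0∞) ∂P) atTop
      (nhds (∫⁻ ω, (N ω : ℝ≥0∞) ∂P)) := by
    refine lintegral_tendsto_of_tendsto_of_monotone (fun K =>
      ((measurable_from_top (f := fun n : ℕ => (n : ℝ≥0∞))).comp
        (hNm.min measurable_const)).aemeasurable) (ae_of_all _ fun ω K K' hK => ?_)
      (ae_of_all _ fun ω => ?_)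
    · simp only
      gcongr
    · refine tendsto_const_nhds.congr' ?_
      filter_upwards [eventually_ge_atTop (N ω)] with K hK
      rw [min_eq_left hK]
  have hIlim : Tendsto (fun L : ℕ => I L γ) atTop
      (nhds (∫⁻ ω, (X ω (.inr (.inr [])) : ℝ≥0∞) ^ γ ∂P)) := by
    refine lintegral_tendsto_of_tendsto_of_monotone (fun L => (hm L γ).aemeasurable)
      (ae_of_all _ fun ω L L' hL => ?_) (ae_of_all _ fun ω => ?_)
    · simp only
      split_ifs with h1 h2 h2
      · exact le_rfl
      · exact absurd (h1.trans (by exact_mod_cast hL)) h2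
      · exact zero_le
      · exact le_rfl
    · refine tendsto_const_nhds.congr' ?_
      obtain ⟨n, hn⟩ := exists_nat_ge (X ω (.inr (.inr [])))
      filter_upwards [eventually_ge_atTop n] with L hL
      rw [if_pos (hn.trans (by exact_mod_cast hL))]
  have hne : (∫⁻ ω, (N ω : ℝ≥0∞) ∂P) ≠ 0 := fun h0 => by
    rw [h0] at hφγ
    simp at hφγ
  have hne' : ∫⁻ ω, (X ω (.inr (.inr [])) : ℝ≥0∞) ^ γ ∂P ≠ 0 := fun h0 => by
    rw [h0] at hφγ
    simp at hφγ
  -- A single K serves as the cap for both the number of children and the factor.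
  obtain ⟨K, hK1, hK0⟩ := (((ENNReal.Tendsto.mul hNlim (Or.inl hne) hIlim (Or.inl hne')).eventually
    (lt_mem_nhds hφγ)).and (eventually_gt_atTop 0)).exists
  set L : ℝ≥0 := (Nat.cast K : ℝ≥0) with hL
  have hLpos : 0 < L := by simpa [hL] using hK0
  set M : ℝ≥0∞ := ∫⁻ ω, ((min (N ω) K : ℕ) : ℝ≥0∞) ∂P with hM
  have hMN : M ≤ ∫⁻ ω, (N ω : ℝ≥0∞) ∂P := lintegral_mono fun ω => by
    simp only; gcongr; exact min_le_left _ _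
  have hMtop : M ≠ ∞ := ne_top_of_le_ne_top hN hMN
  have hItop : ∀ p : ℝ, 0 < p → I L p ≠ ∞ := fun p hp => by
    refine ne_top_of_le_ne_top (b := (L : ℝ≥0∞) ^ p) (ENNReal.rpow_ne_top_of_nonneg hp.le (by simp)) ?_
    calc I L p ≤ ∫⁻ _, (L : ℝ≥0∞) ^ p ∂P := lintegral_mono fun ω => by
          simp only
          split_ifs with h1
          · gcongr
          · exact zero_le
      _ = _ := by simp
  set m := M.toReal with hm'
  set a := (I L γ).toReal with ha
  set b := (I L β).toReal with hb
  have hma : 1 < m * a := by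
    rw [hm', ha, ← ENNReal.toReal_mul, ← ENNReal.toReal_one]
    exact (ENNReal.toReal_lt_toReal (by simp)
      (ENNReal.mul_ne_top hMtop (hItop γ hγ))).2 hK1
  have hmb : m * b < 1 := by
    rw [hm', hb, ← ENNReal.toReal_mul, ← ENNReal.toReal_one]
    refine (ENNReal.toReal_lt_toReal (ENNReal.mul_ne_top hMtop (hItop β hβ)) (by simp)).2
      (lt_of_le_of_lt ?_ hφβ)
    refine mul_le_mul' hMN (lintegral_mono fun ω => ?_)
    simp only
    split_ifs
    · exact le_rfl
    · exact zero_le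
  have hm0 : 0 ≤ m := ENNReal.toReal_nonneg
  have ha0 : 0 < a := by
    by_contra! hcon
    nlinarith
  have hb0 : 0 ≤ b := ENNReal.toReal_nonneg
  -- From mb < 1 < ma; it lets the correction term carry the same factor ρ as the main term.
  have hba : b ≤ a := by
    by_contra! hcon
    nlinarith
  set p : ℝ → ℝ := fun t => P.real {ω | ENNReal.ofReal t < truncatedWeight L (X ω)} with hp
  set g : ℝ → ℝ := fun t => P.real {ω | ENNReal.ofReal t < total (X ω)} with hg
  have hbonf : ∀ t, m * p t ≤ g t + K ^ 2 * p t ^ 2 := by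
    intro t
    have h1 := (h.isRandomSum (measurable_truncatedWeight L)).lintegral_min_mul_measure_le K
      (ENNReal.ofReal t)
    have h2 : P {ω | ∃ i ∈ Finset.Icc 1 ((X ω).offspring []),
        ENNReal.ofReal t < truncatedWeight L ((X ω).subtree i)} ≤
        P {ω | ENNReal.ofReal t < total (X ω)} := by
      refine measure_mono ?_
      rintro ω ⟨i, hi, hω⟩
      exact lt_of_lt_of_le hω (truncatedWeight_subtree_le L hi)
    have h3 := ENNReal.toReal_mono (by finiteness) (h1.trans (add_le_add_left h2 _))
    rw [ENNReal.toReal_add (by finiteness) (by finiteness)] at h3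
    simp only [ENNReal.toReal_mul, ENNReal.toReal_pow, ENNReal.toReal_natCast] at h3
    exact h3
  have hpg : ∀ t, 0 ≤ t → p t ≤ g (t / L) := by
    intro t ht
    refine measureReal_mono fun ω hω => ?_
    have h1 : ENNReal.ofReal t < L * total (X ω) := lt_of_lt_of_le hω (truncatedWeight_le L _)
    have e : ENNReal.ofReal t = L * ENNReal.ofReal (t / L) := by
      rw [← ENNReal.ofReal_coe_nnreal, ← ENNReal.ofReal_mul (NNReal.zero_le_coe (q := L)),
        mul_div_cancel₀ _ (NNReal.coe_pos.2 hLpos).ne']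
    rw [e] at h1
    exact lt_of_mul_lt_mul_left' h1
  have hptend : Tendsto p atTop (nhds 0) := by
    refine tendsto_of_tendsto_of_tendsto_of_le_of_le' tendsto_const_nhds
      (htend.comp (tendsto_id.atTop_div_const (NNReal.coe_pos.2 hLpos)))
      (Eventually.of_forall fun t => measureReal_nonneg) ?_
    filter_upwards [eventually_ge_atTop 0] with t ht
    exact hpg t ht
  obtain ⟨δ, hδ0, hδ⟩ : ∃ δ : ℝ, 0 < δ ∧ 1 < (m - δ) * a := by
    -- This choice gives (m - δ)a = (ma + 1)/2.
    refine ⟨(m * a - 1) / (2 * a), div_pos (by linarith) (by positivity), ?_⟩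
    have : (m - (m * a - 1) / (2 * a)) * a = m * a - (m * a - 1) / 2 := by
      field_simp
    rw [this]
    linarith
  obtain ⟨t₀, ht₀, hK⟩ : ∃ t₀ : ℝ, 0 < t₀ ∧ ∀ t, t₀ ≤ t → (K : ℝ) ^ 2 * p t ≤ δ := by
    have h1 : Tendsto (fun t => (K : ℝ) ^ 2 * p t) atTop (nhds 0) := by
      simpa using hptend.const_mul ((K : ℝ) ^ 2)
    obtain ⟨t₁, h2⟩ := eventually_atTop.1 (h1.eventually (ge_mem_nhds hδ0))
    exact ⟨max t₁ 1, by positivity, fun t ht => h2 t ((le_max_left _ _).trans ht)⟩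
  have hmδ : 0 ≤ m - δ := by
    by_contra! hcon
    nlinarith
  have hgp : ∀ t, t₀ ≤ t → (m - δ) * p t ≤ g t := by
    intro t ht
    have h1 := hbonf t
    have h2 := hK t ht
    have h3 : 0 ≤ p t := measureReal_nonneg
    nlinarith
  have hstep : ∀ t, t₀ ≤ t → ∀ A B : ℝ, 0 ≤ A → 0 ≤ B →
      (∀ s, t / L ≤ s → A * s ^ (-γ) ≤ g s + B * s ^ (-β)) →
      (m - δ) * a * (A * t ^ (-γ)) ≤ g t + (m - δ) * a * (B * t ^ (-β)) := by
    intro t ht A B hA hB hs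
    have ht0 : 0 < t := ht₀.trans_le ht
    have h1 := h.le_measure_lt_truncatedWeight hβ hγ ht0 hA hB hs
    have h2 := ENNReal.toReal_mono (ENNReal.add_ne_top.2 ⟨measure_ne_top _ _,
      ENNReal.mul_ne_top (by simp) (hItop β hβ)⟩) h1
    rw [ENNReal.toReal_add (measure_ne_top _ _) (ENNReal.mul_ne_top (by simp) (hItop β hβ)),
      ENNReal.toReal_mul, ENNReal.toReal_mul, ENNReal.toReal_ofReal (by positivity),
      ENNReal.toReal_ofReal (by positivity)] at h2
    have h3 : A * t ^ (-γ) * a ≤ p t + B * t ^ (-β) * b := h2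
    have h4 : B * t ^ (-β) * b ≤ B * t ^ (-β) * a := by gcongr
    have h5 := mul_le_mul_of_nonneg_left (h3.trans (by linarith : _ ≤ p t + B * t ^ (-β) * a)) hmδ
    linarith [hgp t ht]
  obtain ⟨c, hc, hcb⟩ := Real.exists_mul_rpow_neg_le_of_step (g := g) (β := β) (γ := γ) (t₀ := t₀)
    (L := L) (ρ := (m - δ) * a)
    (fun s t hst => measureReal_mono fun ω hω => (ENNReal.ofReal_le_ofReal hst).trans_lt hω)
    hpos hβγ hγ ht₀ (NNReal.coe_pos.2 hLpos) hδ hstep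
  exact ⟨c, t₀, hc, hcb⟩

end IsBranching

end BranchingTree

/-! ### The moment function of C -/

namespace ENNReal

theorem rpow_le_one_add_rpow (x : ℝ≥0∞) {p q : ℝ} (hp : 0 ≤ p) (hpq : p ≤ q) :
    x ^ p ≤ 1 + x ^ q := by
  rcases le_total x 1 with h | h
  · exact (ENNReal.rpow_le_one h hp).trans le_self_add
  · exact (ENNReal.rpow_le_rpow_of_exponent_le h hpq).trans le_add_self

end ENNReal

namespace MeasureTheory

variable {Ω : Type*} [MeasurableSpace Ω] {P : Measure Ω}

theorem lintegral_rpow_ne_top_of_le [IsFiniteMeasure P] {f : Ω → ℝ≥0∞} {p q : ℝ} (hp : 0 ≤ p)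
    (hpq : p ≤ q) (h : ∫⁻ ω, f ω ^ q ∂P ≠ ∞) : ∫⁻ ω, f ω ^ p ∂P ≠ ∞ := by
  refine ne_top_of_le_ne_top ?_ (lintegral_mono fun ω => ENNReal.rpow_le_one_add_rpow (f ω) hp hpq)
  rw [lintegral_add_left measurable_const]
  simp [h]

/-- A multiple of the moments of a random variable that is below `1` at an exponent and at most
`1` at a larger one is below `1` in between. -/
theorem mul_lintegral_rpow_lt_one {c : Ω → ℝ≥0} (hc : Measurable c) {a : ℝ≥0∞} {p q r : ℝ}
    (hp0 : 0 < p) (hpr : p < r) (hrq : r < q) (hp : a * ∫⁻ ω, (c ω : ℝ≥0∞) ^ p ∂P < 1)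
    (hq : a * ∫⁻ ω, (c ω : ℝ≥0∞) ^ q ∂P ≤ 1) : a * ∫⁻ ω, (c ω : ℝ≥0∞) ^ r ∂P < 1 := by
  have hqp : 0 < q - p := by linarith
  set θ : ℝ≥0 := ⟨(q - r) / (q - p), div_nonneg (by linarith) hqp.le⟩ with hθ
  set η : ℝ≥0 := ⟨(r - p) / (q - p), div_nonneg (by linarith) hqp.le⟩ with hη
  have hθ0 : θ ≠ 0 := by
    rw [← NNReal.coe_ne_zero]
    exact (div_pos (by linarith) hqp).ne'
  have hsum : θ + η = 1 := by
    rw [← NNReal.coe_inj]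
    change (q - r) / (q - p) + (r - p) / (q - p) = 1
    field_simp
    ring
  have hr : p * θ + q * η = r := by
    change p * ((q - r) / (q - p)) + q * ((r - p) / (q - p)) = r
    field_simp
    ring
  -- Convexity of the exponent ↦ x^exponent, through the weighted AM-GM inequality.
  have hpt : ∀ x : ℝ≥0, (x : ℝ≥0∞) ^ r ≤ θ * (x : ℝ≥0∞) ^ p + η * (x : ℝ≥0∞) ^ q := by
    intro x
    have hq0 : 0 < q := by linarith
    rw [← ENNReal.coe_rpow_of_nonneg _ (by linarith : 0 ≤ r),
      ← ENNReal.coe_rpow_of_nonneg _ hp0.le, ← ENNReal.coe_rpow_of_nonneg _ hq0.le]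
    have := NNReal.geom_mean_le_arith_mean2_weighted θ η (x ^ p) (x ^ q) hsum
    rw [← NNReal.rpow_mul, ← NNReal.rpow_mul, ← NNReal.rpow_add_of_nonneg _ (by positivity)
      (by positivity), hr] at this
    exact_mod_cast this
  have hm : ∀ s : ℝ, Measurable fun ω => (c ω : ℝ≥0∞) ^ s := fun s => by fun_prop
  calc a * ∫⁻ ω, (c ω : ℝ≥0∞) ^ r ∂P
      ≤ a * ∫⁻ ω, (θ * (c ω : ℝ≥0∞) ^ p + η * (c ω : ℝ≥0∞) ^ q) ∂P := by
        gcongr with ω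
        exact hpt _
    _ = θ * (a * ∫⁻ ω, (c ω : ℝ≥0∞) ^ p ∂P) + η * (a * ∫⁻ ω, (c ω : ℝ≥0∞) ^ q ∂P) := by
        rw [lintegral_add_left ((hm p).const_mul _), lintegral_const_mul _ (hm p),
          lintegral_const_mul _ (hm q)]
        ring
    _ < θ * 1 + η * 1 := by
        refine ENNReal.add_lt_add_of_lt_of_le
          (ENNReal.mul_ne_top ENNReal.coe_ne_top (ne_top_of_le_ne_top ENNReal.one_ne_top hq)) ?_ (by gcongr)
        exact ENNReal.mul_lt_mul_right (by exact_mod_cast hθ0) (by simp) hp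
    _ = 1 := by
        rw [mul_one, mul_one]
        exact_mod_cast hsum

/-- If the moment function has a positive derivative at an exponent then it takes a smaller value
before it. -/
theorem exists_lintegral_rpow_lt [IsProbabilityMeasure P] {c : Ω → ℝ≥0} (hc : Measurable c) {α : ℝ}
    (hα : 0 < α) (hfin : ∫⁻ ω, (c ω : ℝ≥0∞) ^ α ∂P ≠ ∞)
    (hint : Integrable (fun ω => (c ω : ℝ) ^ α * Real.log (c ω)) P)
    (hpos : 0 < ∫ ω, (c ω : ℝ) ^ α * Real.log (c ω) ∂P) :
    ∃ β, 0 < β ∧ β < α ∧ ∫⁻ ω, (c ω : ℝ≥0∞) ^ β ∂P < ∫⁻ ω, (c ω : ℝ≥0∞) ^ α ∂P := by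
  -- Uniform domination to the left of α: for x ≤ 1 one has |x^β log x| ≤ 1/β ≤ 2/α, and for x ≥ 1
  -- raising the exponent to α only helps.
  have hbd : ∀ β, α / 2 < β → β < α → ∀ x : ℝ≥0,
      ‖(x : ℝ) ^ β * Real.log x‖ ≤ ‖(x : ℝ) ^ α * Real.log x‖ + 2 / α := by
    intro β h1 h2 x
    have hβ : 0 < β := by linarith
    have hα2 : 0 < 2 / α := by positivity
    rcases eq_or_ne x 0 with rfl | hx0
    · simp [hα2.le]
    have hx : 0 < (x : ℝ) := NNReal.coe_pos.2 (pos_iff_ne_zero.2 hx0)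
    rcases le_total (x : ℝ) 1 with hx1 | hx1
    · have h3 := Real.abs_log_mul_self_rpow_lt x β hx hx1 hβ
      have h4 : 1 / β ≤ 2 / α := by
        rw [div_le_div_iff₀ hβ hα]; linarith
      rw [mul_comm, Real.norm_eq_abs]
      linarith [norm_nonneg ((x : ℝ) ^ α * Real.log x)]
    · rw [norm_mul, norm_mul]
      have : ‖(x : ℝ) ^ β‖ ≤ ‖(x : ℝ) ^ α‖ := by
        rw [Real.norm_of_nonneg (by positivity), Real.norm_of_nonneg (by positivity)]
        exact Real.rpow_le_rpow_of_exponent_le hx1 h2.le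
      have := mul_le_mul_of_nonneg_right this (norm_nonneg (Real.log x))
      linarith
  have hev : ∀ᶠ β in nhdsWithin α (Set.Iio α), α / 2 < β ∧ β < α :=
    (eventually_nhdsWithin_of_eventually_nhds (lt_mem_nhds (by linarith))).and
      eventually_mem_nhdsWithin
  have hmeas : ∀ β : ℝ, AEStronglyMeasurable (fun ω => (c ω : ℝ) ^ β * Real.log (c ω)) P :=
    fun β => by
      have : Measurable fun ω => (c ω : ℝ) ^ β * Real.log (c ω) := by fun_prop
      exact this.aestronglyMeasurable
  have hlim : Tendsto (fun β => ∫ ω, (c ω : ℝ) ^ β * Real.log (c ω) ∂P)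
      (nhdsWithin α (Set.Iio α)) (nhds (∫ ω, (c ω : ℝ) ^ α * Real.log (c ω) ∂P)) := by
    refine tendsto_integral_filter_of_dominated_convergence
      (fun ω => ‖(c ω : ℝ) ^ α * Real.log (c ω)‖ + 2 / α) (Eventually.of_forall hmeas) ?_
      (hint.norm.add (integrable_const _)) (ae_of_all _ fun ω => ?_)
    · filter_upwards [hev] with β hβ
      exact ae_of_all _ fun ω => hbd β hβ.1 hβ.2 _
    · refine Tendsto.mul_const _ (Tendsto.mono_left ?_ nhdsWithin_le_nhds)
      rcases eq_or_ne (c ω : ℝ) 0 with h0 | h0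
      · rw [h0]
        refine tendsto_const_nhds.congr' ?_
        filter_upwards [lt_mem_nhds hα] with β hβ
        rw [Real.zero_rpow hα.ne', Real.zero_rpow hβ.ne']
      · exact (Real.continuousAt_const_rpow h0).tendsto
  obtain ⟨β, ⟨hβ1, hβα⟩, hβ⟩ := (hev.and (hlim.eventually (lt_mem_nhds hpos))).exists
  have hβ0 : 0 < β := by linarith
  have hconv : ∀ p : ℝ, 0 < p → ∀ x : ℝ≥0, (x : ℝ≥0∞) ^ p = ENNReal.ofReal ((x : ℝ) ^ p) :=
    fun p hp x => by
      rw [← ENNReal.ofReal_rpow_of_nonneg NNReal.zero_le_coe hp.le, ENNReal.ofReal_coe_nnreal]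
  have hintp : ∀ p : ℝ, 0 < p → ∫⁻ ω, (c ω : ℝ≥0∞) ^ p ∂P ≠ ∞ →
      Integrable (fun ω => (c ω : ℝ) ^ p) P := fun p hp h => by
    have hm : Measurable fun ω => (c ω : ℝ) ^ p := by fun_prop
    refine ⟨hm.aestronglyMeasurable, ?_⟩
    rw [hasFiniteIntegral_iff_ofReal (ae_of_all _ fun ω => by positivity)]
    simp_rw [← hconv p hp]
    exact h.lt_top
  have hfinβ := lintegral_rpow_ne_top_of_le hβ0.le hβα.le hfin
  have hIα := hintp α hα hfin
  have hIβ := hintp β hβ0 hfinβ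
  refine ⟨β, hβ0, hβα, ?_⟩
  simp_rw [hconv β hβ0, hconv α hα]
  rw [← ofReal_integral_eq_lintegral_ofReal hIβ (ae_of_all _ fun ω => by positivity),
    ← ofReal_integral_eq_lintegral_ofReal hIα (ae_of_all _ fun ω => by positivity)]
  have hlt : ∫ ω, (c ω : ℝ) ^ β ∂P < ∫ ω, (c ω : ℝ) ^ α ∂P := by
    have hIl : Integrable (fun ω => (c ω : ℝ) ^ β * Real.log (c ω)) P :=
      (hint.norm.add (integrable_const (2 / α))).mono' (hmeas β)
        (ae_of_all _ fun ω => hbd β hβ1 hβα _)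
    -- The tangent at β, by e^y ≥ 1 + y. This is why positivity of the logarithmic moment was first
    -- carried from α to β.
    have hpt : ∀ ω, (α - β) * ((c ω : ℝ) ^ β * Real.log (c ω)) ≤ (c ω : ℝ) ^ α - (c ω : ℝ) ^ β := by
      intro ω
      generalize c ω = x
      rcases eq_or_ne x 0 with rfl | hx0
      · simp [Real.zero_rpow hα.ne', Real.zero_rpow hβ0.ne']
      have hx : 0 < (x : ℝ) := NNReal.coe_pos.2 (pos_iff_ne_zero.2 hx0)
      have e : (x : ℝ) ^ α = (x : ℝ) ^ β * Real.exp (Real.log x * (α - β)) := by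
        rw [← Real.rpow_def_of_pos hx, ← Real.rpow_add hx, add_sub_cancel]
      rw [e]
      have h1 := Real.add_one_le_exp (Real.log x * (α - β))
      have h2 : 0 ≤ (x : ℝ) ^ β := by positivity
      nlinarith
    have h3 := integral_mono (hIl.const_mul (α - β)) (hIα.sub hIβ) hpt
    simp only [Pi.sub_apply] at h3
    rw [integral_const_mul, integral_sub hIα hIβ] at h3
    nlinarith [mul_pos (sub_pos.2 hβα) hβ]
  exact (ENNReal.ofReal_lt_ofReal_iff_of_nonneg (integral_nonneg fun ω => by positivity)).2 hlt

end MeasureTheory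

/-- Exponents within εα/2 of α use up half of the tolerance εα log t; the other half absorbs the
constants log B and log c. -/
theorem Asymptotics.isEquivalent_log_of_rpow_bounds {g : ℝ → ℝ} {α : ℝ} (hα : 0 < α)
    (hg : ∀ t, 0 < g t)
    (hup : ∃ β₁ < α, ∀ β, β₁ < β → β < α → ∃ B, ∀ᶠ t in atTop, g t ≤ B * t ^ (-β))
    (hlow : ∀ γ, α < γ → ∃ c, 0 < c ∧ ∀ᶠ t in atTop, c * t ^ (-γ) ≤ g t) :
    (fun t => Real.log (g t)) ~[atTop] fun t => -α * Real.log t := by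
  obtain ⟨β₁, hβ₁, hup⟩ := hup
  refine isLittleO_iff.2 fun ε hε => ?_
  have hεα : 0 < ε * α := by positivity
  have hβmax : max β₁ (α - ε * α / 2) < α := max_lt hβ₁ (by linarith)
  obtain ⟨β, hβ1, hβ2⟩ := exists_between hβmax
  obtain ⟨B, hB⟩ := hup β ((le_max_left _ _).trans_lt hβ1) hβ2
  obtain ⟨c, hc, hcb⟩ := hlow (α + ε * α / 2) (by linarith)
  have hβ3 : α - ε * α / 2 < β := (le_max_right _ _).trans_lt hβ1
  filter_upwards [hB, hcb, eventually_gt_atTop 0,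
    Real.tendsto_log_atTop.eventually_ge_atTop 0,
    Real.tendsto_log_atTop.eventually_ge_atTop (Real.log B / (ε * α / 2)),
    Real.tendsto_log_atTop.eventually_ge_atTop (-Real.log c / (ε * α / 2))]
    with t h1 h2 ht hlog hlogB hlogc
  have hBpos : 0 < B := by
    by_contra! hcon
    have := mul_nonpos_of_nonpos_of_nonneg hcon (by positivity : 0 ≤ t ^ (-β))
    linarith [hg t]
  have h3 := Real.log_le_log (hg t) h1
  have h4 := Real.log_le_log (by positivity) h2
  rw [Real.log_mul hBpos.ne' (by positivity), Real.log_rpow ht] at h3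
  rw [Real.log_mul hc.ne' (by positivity), Real.log_rpow ht] at h4
  rw [div_le_iff₀ (by positivity)] at hlogB hlogc
  have h5 : (α - ε * α / 2) * Real.log t ≤ β * Real.log t := by gcongr
  simp only [Pi.sub_apply]
  rw [Real.norm_eq_abs, Real.norm_eq_abs, abs_mul, abs_neg, abs_of_pos hα, abs_of_nonneg hlog,
    abs_le]
  constructor <;> nlinarith

/-! ### Conclusion -/

namespace BranchingTree

open Marks

theorem Marks.measureReal_lt_total_le {Ω : Type*} [MeasurableSpace Ω] {P : Measure Ω}
    [IsProbabilityMeasure P] {X : Ω → Marks} (hX : Measurable X) {β : ℝ} (hβ : 0 < β) {B : ℝ≥0∞}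
    (hBtop : B ≠ ∞) (hB : ∫⁻ ω, total (X ω) ^ β ∂P ≤ B) {t : ℝ} (ht : 0 < t) :
    P.real {ω | ENNReal.ofReal t < total (X ω)} ≤ B.toReal * t ^ (-β) := by
  have h1 := mul_meas_ge_le_lintegral (μ := P) ((measurable_total.comp hX).pow_const β)
    (ENNReal.ofReal t ^ β)
  have h2 : P {ω | ENNReal.ofReal t < total (X ω)} ≤
      P {ω | ENNReal.ofReal t ^ β ≤ total (X ω) ^ β} :=
    measure_mono fun ω (hω : ENNReal.ofReal t < total (X ω)) => ENNReal.rpow_le_rpow hω.le hβ.le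
  have h3 := ENNReal.toReal_mono hBtop (((mul_le_mul_right h2 _).trans h1).trans hB)
  rw [ENNReal.toReal_mul, ENNReal.ofReal_rpow_of_pos ht, ENNReal.toReal_ofReal (by positivity)] at h3
  rw [Real.rpow_neg ht.le, ← div_eq_mul_inv, le_div_iff₀ (by positivity), mul_comm]
  exact h3

/-- The tail of the total weight of a branching tree is regularly varying on the logarithmic
scale. -/
theorem IsBranching.isEquivalent_log_measureReal {Ω : Type*} [MeasurableSpace Ω] {P : Measure Ω}
    [IsProbabilityMeasure P] {X : Ω → Marks} (h : IsBranching P X) {α : ℝ} (hα : 0 < α)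
    (hlog_int : Integrable (fun ω => (X ω (.inr (.inr [])) : ℝ) ^ α *
      Real.log (X ω (.inr (.inr [])))) P)
    (hlog_pos : 0 < ∫ ω, (X ω (.inr (.inr [])) : ℝ) ^ α * Real.log (X ω (.inr (.inr []))) ∂P)
    (hNC : (∫⁻ ω, ((X ω).offspring [] : ℝ≥0∞) ∂P) *
      ∫⁻ ω, (X ω (.inr (.inr [])) : ℝ≥0∞) ^ α ∂P = 1)
    (hQ0 : ∫⁻ ω, (X ω (.inr (.inl [])) : ℝ≥0∞) ^ α ∂P ≠ 0)
    (hQ : ∫⁻ ω, (X ω (.inr (.inl [])) : ℝ≥0∞) ^ α ∂P ≠ ∞)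
    (hN : ∫⁻ ω, ((X ω).offspring [] : ℝ≥0∞) ^ α ∂P ≠ ∞)
    (hsub : 1 < α → (∫⁻ ω, ((X ω).offspring [] : ℝ≥0∞) ∂P) *
      ∫⁻ ω, (X ω (.inr (.inr [])) : ℝ≥0∞) ∂P < 1) :
    (fun t : ℝ => Real.log (P.real {ω | ENNReal.ofReal t < total (X ω)})) ~[atTop]
      fun t : ℝ => -α * Real.log t := by
  have hc := h.measurable (.inr (.inr []))
  set n := ∫⁻ ω, ((X ω).offspring [] : ℝ≥0∞) ∂P with hn
  have hn0 : n ≠ 0 := fun h0 => by simp [h0] at hNC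
  have hC0 : ∫⁻ ω, (X ω (.inr (.inr [])) : ℝ≥0∞) ^ α ∂P ≠ 0 := fun h0 => by
    rw [h0] at hNC; simp at hNC
  have hn1 : n ≠ ∞ := fun h0 => by
    rw [h0, ENNReal.top_mul hC0] at hNC; simp at hNC
  have hC1 : ∫⁻ ω, (X ω (.inr (.inr [])) : ℝ≥0∞) ^ α ∂P ≠ ∞ := fun h0 => by
    rw [h0, ENNReal.mul_top hn0] at hNC; simp at hNC
  obtain ⟨β₀, hβ₀, hβ₀α, hlt⟩ := exists_lintegral_rpow_lt hc hα hC1 hlog_int hlog_pos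
  have hφ₀ : n * ∫⁻ ω, (X ω (.inr (.inr [])) : ℝ≥0∞) ^ β₀ ∂P < 1 := by
    rw [← hNC]
    exact ENNReal.mul_lt_mul_right hn0 hn1 hlt
  have hφ : ∀ β, β₀ < β → β < α → n * ∫⁻ ω, (X ω (.inr (.inr [])) : ℝ≥0∞) ^ β ∂P < 1 :=
    fun β h1 h2 => mul_lintegral_rpow_lt_one hc hβ₀ h1 h2 hφ₀ hNC.le
  -- The point β₀ may lie above 1; interpolating from the exponent 1 gives φ < 1 on the whole of [1,
  -- α), as the induction on moments requires.
  have hφ1 : 1 < α → ∀ β, 1 ≤ β → β < α →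
      n * ∫⁻ ω, (X ω (.inr (.inr [])) : ℝ≥0∞) ^ β ∂P < 1 := by
    intro hα1 β h1 h2
    have h3 : n * ∫⁻ ω, (X ω (.inr (.inr [])) : ℝ≥0∞) ^ (1 : ℝ) ∂P < 1 := by
      simpa only [ENNReal.rpow_one] using hsub hα1
    rcases h1.eq_or_lt with rfl | h1
    · exact h3
    · exact mul_lintegral_rpow_lt_one hc one_pos h1 h2 h3 hNC.le
  have hφγ : ∀ γ, α < γ → 1 < n * ∫⁻ ω, (X ω (.inr (.inr [])) : ℝ≥0∞) ^ γ ∂P := by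
    intro γ hγ
    -- If φ(γ) ≤ 1, interpolation between β₀ and γ would force φ(α) < 1.
    by_contra! hcon
    exact (mul_lintegral_rpow_lt_one hc hβ₀ hβ₀α hγ hφ₀ hcon).ne hNC
  have hmom : ∀ β, β₀ < β → (1 < α → 1 ≤ β) → β < α →
      ∃ B : ℝ≥0∞, B ≠ ∞ ∧ ∫⁻ ω, total (X ω) ^ β ∂P ≤ B := by
    intro β h1 h2 h3
    have hβ : 0 < β := hβ₀.trans h1
    suffices ∃ B : ℝ≥0∞, B ≠ ∞ ∧ ∀ n, ∫⁻ ω, partialWeight n (X ω) ^ β ∂P ≤ B by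
      obtain ⟨B, hB, hle⟩ := this
      exact ⟨B, hB, lintegral_total_rpow_le hβ h.measurable' hle⟩
    rcases le_or_gt α 1 with hα1 | hα1
    · exact h.exists_lintegral_partialWeight_rpow_le_of_le_one hβ (h3.le.trans hα1)
        (lintegral_rpow_ne_top_of_le hβ.le h3.le hQ) (hφ β h1 h3)
    · exact h.exists_lintegral_partialWeight_rpow_le (h2 hα1)
        (fun γ hγ1 hγ2 => lintegral_rpow_ne_top_of_le (by linarith) (hγ2.trans h3.le) hQ)
        (fun γ hγ1 hγ2 => lintegral_rpow_ne_top_of_le (by linarith) (hγ2.trans h3.le) hN)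
        (fun γ hγ1 hγ2 => lintegral_rpow_ne_top_of_le (by linarith) (hγ2.trans h3.le) hC1)
        (fun γ hγ1 hγ2 => hφ1 hα1 γ hγ1 (hγ2.trans_lt h3))
  have hup : ∃ β₁ < α, ∀ β, β₁ < β → β < α → ∃ B, ∀ᶠ t in atTop,
      P.real {ω | ENNReal.ofReal t < total (X ω)} ≤ B * t ^ (-β) := by
    have key : ∀ β, β₀ < β → (1 < α → 1 ≤ β) → β < α → ∃ B, ∀ᶠ t in atTop,
        P.real {ω | ENNReal.ofReal t < total (X ω)} ≤ B * t ^ (-β) := by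
      intro β h1 h2 h3
      obtain ⟨B, hB, hle⟩ := hmom β h1 h2 h3
      refine ⟨B.toReal, ?_⟩
      filter_upwards [eventually_gt_atTop 0] with t ht
      exact measureReal_lt_total_le h.measurable' (hβ₀.trans h1) hB hle ht
    rcases le_or_gt α 1 with hα1 | hα1
    · exact ⟨β₀, hβ₀α, fun β h1 h2 => key β h1 (fun h => absurd h hα1.not_gt) h2⟩
    · exact ⟨max β₀ 1, max_lt hβ₀α hα1, fun β h1 h2 => key β ((le_max_left _ _).trans_lt h1)
        (fun _ => ((le_max_right _ _).trans_lt h1).le) h2⟩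
  have hpos : ∀ t, 0 < P.real {ω | ENNReal.ofReal t < total (X ω)} := by
    refine h.measure_lt_total_pos (fun h0 => hQ0 ?_) (fun h0 => hn0 ?_) fun h0 => ?_
    · rw [lintegral_eq_zero_iff ((h.measurable _).coe_nnreal_ennreal.pow_const α)]
      filter_upwards [measure_eq_zero_iff_ae_notMem.1 h0] with ω hω
      have : X ω (.inr (.inl [])) = 0 := by simpa using hω
      simp [this, hα]
    · have hm : Measurable fun ω => ((X ω).offspring [] : ℝ≥0∞) :=
        (measurable_from_top (f := fun n : ℕ => (n : ℝ≥0∞))).comp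
          ((measurable_offspring _).comp h.measurable')
      rw [hn, lintegral_eq_zero_iff hm]
      filter_upwards [measure_eq_zero_iff_ae_notMem.1 h0] with ω hω
      have : (X ω).offspring [] = 0 := by simpa using hω
      simp [this]
    -- If C ≤ 1 almost surely, then C^α log C ≤ 0.
    · refine hlog_pos.not_ge (integral_nonpos_of_ae ?_)
      filter_upwards [measure_eq_zero_iff_ae_notMem.1 h0] with ω hω
      have h1 : X ω (.inr (.inr [])) ≤ 1 := by simpa using hω
      exact mul_nonpos_of_nonneg_of_nonpos (by positivity)
        (Real.log_nonpos NNReal.zero_le_coe (by exact_mod_cast h1))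
  have htend : Tendsto (fun t : ℝ => P.real {ω | ENNReal.ofReal t < total (X ω)}) atTop
      (nhds 0) := by
    obtain ⟨β₁, hβ₁, hup⟩ := hup
    obtain ⟨β, h1, h2⟩ := exists_between (max_lt hβ₁ hα)
    obtain ⟨B, hB⟩ := hup β ((le_max_left _ _).trans_lt h1) h2
    have h3 : Tendsto (fun t : ℝ => B * t ^ (-β)) atTop (nhds 0) := by
      simpa using (tendsto_rpow_neg_atTop ((le_max_right _ _).trans_lt h1)).const_mul B
    exact tendsto_of_tendsto_of_tendsto_of_le_of_le' tendsto_const_nhds h3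
      (Eventually.of_forall fun t => measureReal_nonneg) hB
  refine isEquivalent_log_of_rpow_bounds hα hpos hup fun γ hγ => ?_
  obtain ⟨c, t₀, hc, hle⟩ := h.exists_mul_rpow_neg_le_measure hpos htend hβ₀ (hβ₀α.trans hγ) hn1
    hφ₀ (hφγ γ hγ)
  exact ⟨c, hc, eventually_atTop.2 ⟨t₀, hle⟩⟩

end BranchingTree

theorem theorem3 {Ω : Type*} [MeasurableSpace Ω] (P : Measure Ω) [IsProbabilityMeasure P]
    (N : Ω → ℕ) (Q C : Ω → ℝ≥0)
    (Nt : List ℕ → Ω → ℕ) (Qt Ct : List ℕ → Ω → ℝ≥0)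
    (hmarks : BranchingTree.IsIIDMarking P N Q C Nt Qt Ct)
    (α : ℝ) (hα : 0 < α)
    (hlog_int : Integrable (fun ω => (C ω : ℝ) ^ α * Real.log (C ω : ℝ)) P)
    (hlog_pos : 0 < ∫ ω, (C ω : ℝ) ^ α * Real.log (C ω : ℝ) ∂P)
    (hNC : (∫⁻ ω, (N ω : ℝ≥0∞) ∂P) * (∫⁻ ω, (C ω : ℝ≥0∞) ^ α ∂P) = 1)
    (hQN_pos : 0 < (∫⁻ ω, (Q ω : ℝ≥0∞) ^ α ∂P) * (∫⁻ ω, (N ω : ℝ≥0∞) ^ α ∂P))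
    (hQN_fin : (∫⁻ ω, (Q ω : ℝ≥0∞) ^ α ∂P) * (∫⁻ ω, (N ω : ℝ≥0∞) ^ α ∂P) < ∞)
    (hsub : 1 < α → (∫⁻ ω, (N ω : ℝ≥0∞) ∂P) * (∫⁻ ω, (C ω : ℝ≥0∞) ∂P) < 1) :
    (fun t : ℝ => Real.log (P.real {ω | ENNReal.ofReal t <
        BranchingTree.totalWeight (fun v => Nt v ω) (fun v => Qt v ω) (fun v => Ct v ω)}))
      ~[atTop] (fun t : ℝ => -α * Real.log t) := by
  have h := hmarks.isBranching
  have hC : ∀ p : ℝ, ∫⁻ ω, (Ct [] ω : ℝ≥0∞) ^ p ∂P = ∫⁻ ω, (C ω : ℝ≥0∞) ^ p ∂P := fun p =>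
    ((hmarks.identDistrib_C []).comp
      (u := fun x : ℝ≥0 => (x : ℝ≥0∞) ^ p) (by fun_prop)).lintegral_eq
  have hQ : ∀ p : ℝ, ∫⁻ ω, (Qt [] ω : ℝ≥0∞) ^ p ∂P = ∫⁻ ω, (Q ω : ℝ≥0∞) ^ p ∂P := fun p =>
    ((hmarks.identDistrib_Q []).comp
      (u := fun x : ℝ≥0 => (x : ℝ≥0∞) ^ p) (by fun_prop)).lintegral_eq
  have hN : ∀ p : ℝ, ∫⁻ ω, (Nt [] ω : ℝ≥0∞) ^ p ∂P = ∫⁻ ω, (N ω : ℝ≥0∞) ^ p ∂P := fun p =>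
    ((hmarks.identDistrib_N []).comp
      (u := fun x : ℕ => (x : ℝ≥0∞) ^ p) measurable_from_top).lintegral_eq
  have hC1 := hC 1
  have hN1 := hN 1
  simp only [ENNReal.rpow_one] at hC1 hN1
  have hlog := (hmarks.identDistrib_C []).comp
    (u := fun x : ℝ≥0 => (x : ℝ) ^ α * Real.log x) (by fun_prop)
  have hX : ∀ ω, (BranchingTree.marksOf Nt Qt Ct ω).offspring [] = Nt [] ω := fun ω =>
    Nat.floor_natCast _
  -- A nonzero product has nonzero factors, so finiteness of the product gives finiteness of each
  -- factor.
  have hmul := hQN_pos.ne'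
  rw [Ne, mul_eq_zero, not_or] at hmul
  have key := h.isEquivalent_log_measureReal hα (hlog.integrable_iff.2 hlog_int)
    (hlog_pos.trans_eq hlog.integral_eq.symm)
    (by simp_rw [hX]; rw [hN1]; exact (congrArg _ (hC α)).trans hNC)
    (fun h0 => hmul.1 ((hQ α).symm.trans h0))
    (fun h0 => by
      rw [← hQ α] at hQN_fin
      exact hQN_fin.ne (ENNReal.mul_eq_top.2 (Or.inr ⟨h0, hmul.2⟩)))
    (fun h0 => by
      simp_rw [hX, hN] at h0
      exact hQN_fin.ne (ENNReal.mul_eq_top.2 (Or.inl ⟨hmul.1, h0⟩)))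
    (fun h1 => by
      simp_rw [hX]; rw [hN1]
      exact (congrArg _ hC1).trans_lt (hsub h1))
  simpa only [BranchingTree.total_marksOf] using key
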